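/- Let $n,k\ge 0$ be integers and let $I\subset[n+1]=\{1,\dots,n+1\}$ with $|I|=2k$. Let $K_{A_n}$ be the simplicial complex whose vertices are the nonempty proper subsets of $[n+1]$ and whose simplices are the sets of pairwise nested vertices (the Coxeter complex of type $A_n$), and let $(K_{A_n})_I$ be its full subcomplex on the vertices $J$ with $|J\cap I|$ odd. Let $\widetilde H_{k-1}((K_{A_n})_I)$ be its reduced simplicial homology over $\mathbb Q$ in degree $k-1$ (the empty simplex being the only simplex of degree $-1$), where simplices $J_0\subsetneq\cdots\subsetneq J_p$ are oriented by inclusion. Let $\mathrm{Perm}_I$ be the set of permutations of $I$, written in one-line notation $x=(x_1x_2/\cdots/x_{2k-1}x_{2k})$, and let $\mathbb Q\langle\mathrm{Perm}_I\rangle$ be the $\mathbb Q$-vector space with basis $\mathrm{Perm}_I$. Let $M_I\subset\mathbb Q\langle\mathrm{Perm}_I\rangle$ be the subspace spanned by the following elements, for all $x\in\mathrm{Perm}_I$: 1. $(\cdots/x_{2i-1}x_{2i}/\cdots)+(\cdots/x_{2i}x_{2i-1}/\cdots)$ for $1\le i\le k$; 2. $(\cdots/ab/cd/\cdots)-(\cdots/ac/bd/\cdots)+(\cdots/ad/bc/\cdots)+(\cdots/bc/ad/\cdots)-(\cdots/bd/ac/\cdots)+(\cdots/cd/ab/\cdots)$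 for $1\le i\le k-1$, where $(a,b,c,d)=(x_{2i-1},x_{2i},x_{2i+1},x_{2i+2})$; in each case all entries that are not displayed are those of $x$. For $x\in\mathrm{Perm}_I$ and $1\le i\le 2k$ put $\mathrm{set}^x_i=\{x_1,\dots,x_{2\lfloor (i-1)/2\rfloor}\}\cup\{x_i\}$. Let $\Delta_x=\{\mathrm{set}^x_1,\mathrm{set}^x_2\}\star\cdots\star\{\mathrm{set}^x_{2k-1},\mathrm{set}^x_{2k}\}\subset(K_{A_n})_I$, the boundary complex of the $k$-dimensional cross-polytope, and let $[\Delta_x]\in\widetilde H_{k-1}((K_{A_n})_I)$ be the class of its fundamental cycle $$\sum_{\varepsilon\in\{0,1\}^k}(-1)^{\varepsilon_1+\cdots+\varepsilon_k}\,\{\mathrm{set}^x_{1+\varepsilon_1},\mathrm{set}^x_{3+\varepsilon_2},\dots,\mathrm{set}^x_{2k-1+\varepsilon_k}\}.$$ Then there is an isomorphism of $\mathbb Q$-vector spaces $$\mathbb Q\langle\mathrm{Perm}_I\rangle/M_I\;\xrightarrow{\ \cong\ }\;\widetilde H_{k-1}((K_{A_n})_I),\qquad x+M_I\longmapsto[\Delta_x]\quad(x\in\mathrm{Perm}_I).$$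 Moreover, the elements $\alpha+M_I$, where $\alpha$ runs over the alternating permutations of $I$ (that is, $\alpha_1<\alpha_2>\alpha_3<\alpha_4>\cdots<\alpha_{2k}$), form a basis of $\mathbb Q\langle\mathrm{Perm}_I\rangle/M_I$, and their images $[\Delta_\alpha]$ form a basis of $\widetilde H_{k-1}((K_{A_n})_I)$. -/

import Mathlib

/-! ### Reduced simplicial homology over `ℚ` of complexes whose simplices are chains of a poset -/

/-- The full subcomplex of `K` on the vertices that lie in `W`. -/
def PreAbstractSimplicialComplex.fullSubcomplex {V : Type*} (K : PreAbstractSimplicialComplex V)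
    (W : Set V) : PreAbstractSimplicialComplex V where
  faces := {s | s ∈ K.faces ∧ ∀ v ∈ s, v ∈ W}
  isRelLowerSet_faces := by
    rintro s ⟨hs, hW⟩
    refine ⟨(K.isRelLowerSet_faces hs).1, fun t hts ht => ?_⟩
    exact ⟨(K.isRelLowerSet_faces hs).2 hts ht, fun v hv => hW v (hts hv)⟩

namespace Permutohedral

section Homology

variable {V : Type*} [PartialOrder V] [DecidableEq V] [DecidableLT V]

/-- The boundary operator. A simplex `s` that is a chain `v₀ < v₁ < ⋯ < v_p` carries the orientation
given by this order, and `∂ s = ∑ⱼ (-1)ʲ (s \ {vⱼ})`; here `j` is the number of `w ∈ s` with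
`w < vⱼ`. A single vertex is sent to the empty simplex (the augmentation), and the empty simplex is
sent to `0`. -/
noncomputable def boundary : (Finset V →₀ ℚ) →ₗ[ℚ] (Finset V →₀ ℚ) :=
  Finsupp.linearCombination ℚ fun s : Finset V =>
    ∑ v ∈ s, Finsupp.single (s.erase v) ((-1 : ℚ) ^ (s.filter (fun w => w < v)).card)

/-- The augmented simplicial chains of `K` in degree `p`: combinations of simplices with `p + 1`
vertices, where the empty simplex is the only simplex of degree `-1`. -/
noncomputable def chains (K : PreAbstractSimplicialComplex V) (p : ℤ) :
    Submodule ℚ (Finset V →₀ ℚ) :=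
  Finsupp.supported ℚ ℚ {s : Finset V | (s = ∅ ∨ s ∈ K.faces) ∧ (s.card : ℤ) = p + 1}

/-- Reduced cycles in degree `p`. -/
noncomputable def cycles (K : PreAbstractSimplicialComplex V) (p : ℤ) :
    Submodule ℚ (Finset V →₀ ℚ) :=
  chains K p ⊓ LinearMap.ker boundary

/-- Boundaries in degree `p`. -/
noncomputable def boundaries (K : PreAbstractSimplicialComplex V) (p : ℤ) :
    Submodule ℚ (Finset V →₀ ℚ) :=
  (chains K (p + 1)).map boundary

/-- The reduced simplicial homology `H̃_p(K; ℚ)`, for a complex `K` on the elements of a poset every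
face of which is a chain. -/
abbrev ReducedHomology (K : PreAbstractSimplicialComplex V) (p : ℤ) : Type _ :=
  cycles K p ⧸ (boundaries K p).submoduleOf (cycles K p)

end Homology

/-! ### The Coxeter complex of type `A_n` and its full subcomplexes -/

/-- The Coxeter complex `K_{A_n}`: its vertices are the nonempty proper subsets of `[n+1]` (here
`Fin (n + 1)`), its simplices are the nonempty sets of pairwise nested vertices. -/
def coxeterComplex (n : ℕ) : PreAbstractSimplicialComplex (Finset (Fin (n + 1))) where
  faces := {s | s.Nonempty ∧ (∀ J ∈ s, J.Nonempty ∧ J ≠ Finset.univ) ∧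
    IsChain (· ⊆ ·) (s : Set (Finset (Fin (n + 1))))}
  isRelLowerSet_faces := by
    rintro s ⟨hs, hv, hc⟩
    refine ⟨hs, fun t hts ht => ⟨ht, fun J hJ => hv J (hts hJ), ?_⟩⟩
    exact hc.mono (Finset.coe_subset.mpr hts)

/-- `(K_{A_n})_I`: the full subcomplex of `K_{A_n}` on the vertices `J` with `|J ∩ I|` odd. -/
def oddSubcomplex (n : ℕ) (I : Finset (Fin (n + 1))) :
    PreAbstractSimplicialComplex (Finset (Fin (n + 1))) :=
  (coxeterComplex n).fullSubcomplex {J | Odd (J ∩ I).card}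

/-! ### Permutations on `I` and the spheres attached to them -/

variable {n k : ℕ} {I : Finset (Fin (n + 1))}

/-- Permutations on `I` in one-line notation `(x₁x₂/⋯/x₂ₖ₋₁x₂ₖ)`: the entry `x_{j+1}` is `x j`. -/
abbrev PermOn (I : Finset (Fin (n + 1))) (k : ℕ) : Type := Fin (2 * k) ≃ I

/-- The (0-based) positions `2i` (for `false`) and `2i + 1` (for `true`) in the `i`-th block. -/
def pos (i : Fin k) (b : Bool) : Fin (2 * k) :=
  ⟨2 * i.val + b.toNat, by have := i.isLt; have := b.toNat_le; omega⟩

/-- The subset of `[n+1]` that consists of `x j` and of all the entries in the blocks of `x` before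
the block of the position `j`. -/
def entrySet (x : PermOn I k) (j : Fin (2 * k)) : Finset (Fin (n + 1)) :=
  (Finset.univ.filter fun l : Fin (2 * k) => l.val < 2 * (j.val / 2) ∨ l = j).image
    fun l => (x l : Fin (n + 1))

/-- The facet of the cross-polytope `Δ_x` with one vertex chosen from each of its `k` pairs of
antipodal vertices. -/
def facet (x : PermOn I k) (ε : Fin k → Bool) : Finset (Finset (Fin (n + 1))) :=
  Finset.univ.image fun i => entrySet x (pos i (ε i))

/-- The fundamental cycle of the oriented sphere
`Δ_x = {set₁, set₂} ⋆ {set₃, set₄} ⋆ ⋯ ⋆ {set₂ₖ₋₁, set₂ₖ}`, that is, the join product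
`([set₁] - [set₂]) ⋆ ([set₃] - [set₄]) ⋆ ⋯ ⋆ ([set₂ₖ₋₁] - [set₂ₖ])`, multiplied out. -/
noncomputable def sphereChain (x : PermOn I k) : Finset (Finset (Fin (n + 1))) →₀ ℚ :=
  ∑ ε : Fin k → Bool, Finsupp.single (facet x ε) (∏ i, if ε i then (-1 : ℚ) else 1)

theorem mem_entrySet {x : PermOn I k} {i : Fin k} {b : Bool} {a : Fin (n + 1)} :
    a ∈ entrySet x (pos i b) ↔
      ∃ l : Fin (2 * k), (l.val < 2 * i.val ∨ l = pos i b) ∧ (x l : Fin (n + 1)) = a := by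
  have h : 2 * ((pos i b).val / 2) = 2 * i.val := by
    have := b.toNat_le
    simp only [pos]
    omega
  simp [entrySet, h]

theorem card_entrySet (x : PermOn I k) (i : Fin k) (b : Bool) :
    (entrySet x (pos i b)).card = 2 * i.val + 1 := by
  have h : 2 * ((pos i b).val / 2) = 2 * i.val := by
    have := b.toNat_le
    simp only [pos]
    omega
  have hlt : 2 * i.val ≤ (pos i b).val := by simp [pos]
  unfold entrySet
  have hinj : Function.Injective fun l => (x l : Fin (n + 1)) :=
    Subtype.val_injective.comp x.injective
  rw [Finset.card_image_of_injective _ hinj, h, Finset.filter_or, Finset.card_union_of_disjoint]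
  · rw [Finset.filter_eq' Finset.univ (pos i b)]
    have : (Finset.univ.filter fun l : Fin (2 * k) => l.val < 2 * i.val)
        = Finset.Iio (⟨2 * i.val, by have := i.isLt; omega⟩ : Fin (2 * k)) := by
      ext l
      simp [Fin.lt_def]
    rw [this]
    simp
  · rw [Finset.disjoint_left]
    intro l hl hl'
    simp only [Finset.mem_filter, Finset.mem_univ, true_and] at hl hl'
    subst hl'
    omega

theorem entrySet_subset (x : PermOn I k) {i j : Fin k} (hij : i < j) (b c : Bool) :
    entrySet x (pos i b) ⊆ entrySet x (pos j c) := by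
  intro a ha
  obtain ⟨l, hl, rfl⟩ := mem_entrySet.mp ha
  refine mem_entrySet.mpr ⟨l, Or.inl ?_, rfl⟩
  have hij' : i.val < j.val := hij
  have := b.toNat_le
  rcases hl with hl | rfl
  · omega
  · simp only [pos]
    omega

theorem entrySet_injective (x : PermOn I k) (ε : Fin k → Bool) :
    Function.Injective fun i => entrySet x (pos i (ε i)) := by
  intro i j h
  have := congrArg Finset.card h
  simp only [card_entrySet] at this
  exact Fin.ext (by omega)

theorem entrySet_lt_iff (x : PermOn I k) (ε : Fin k → Bool) (i j : Fin k) :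
    entrySet x (pos i (ε i)) < entrySet x (pos j (ε j)) ↔ i < j := by
  constructor
  · intro h
    have := Finset.card_lt_card h
    simp only [card_entrySet] at this
    exact Fin.lt_def.mpr (by omega)
  · intro h
    refine lt_of_le_of_ne (entrySet_subset x h _ _) fun he => ?_
    exact h.ne (entrySet_injective x ε he)

theorem boundary_facet (x : PermOn I k) (ε : Fin k → Bool) :
    boundary (Finsupp.single (facet x ε) 1) =
      ∑ i : Fin k, Finsupp.single
        ((Finset.univ.erase i).image fun j => entrySet x (pos j (ε j))) ((-1 : ℚ) ^ i.val) := by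
  unfold boundary
  rw [Finsupp.linearCombination_single, one_smul]
  unfold facet
  rw [Finset.sum_image (fun i _ j _ h => entrySet_injective x ε h)]
  refine Finset.sum_congr rfl fun i _ => ?_
  rw [Finset.image_erase (entrySet_injective x ε) Finset.univ i, Finset.filter_image,
    Finset.card_image_of_injective _ (entrySet_injective x ε)]
  simp only [entrySet_lt_iff]
  congr 2
  have : (Finset.univ.filter fun l : Fin k => l < i) = Finset.Iio i := by
    ext l
    simp
  rw [this]
  simp

theorem facet_mem (x : PermOn I k) (ε : Fin k → Bool) :
    (facet x ε = ∅ ∨ facet x ε ∈ (oddSubcomplex n I).faces) ∧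
      ((facet x ε).card : ℤ) = ((k : ℤ) - 1) + 1 := by
  constructor
  · rcases (facet x ε).eq_empty_or_nonempty with h | h
    · exact Or.inl h
    right
    have hI : I.card = 2 * k := by
      have := Fintype.card_congr x
      simpa using this.symm
    have hsub : ∀ (i : Fin k) (b : Bool), entrySet x (pos i b) ⊆ I := by
      intro i b a ha
      obtain ⟨l, -, rfl⟩ := mem_entrySet.mp ha
      exact (x l).2
    refine ⟨⟨h, ?_, ?_⟩, ?_⟩
    · intro J hJ
      obtain ⟨i, -, rfl⟩ := Finset.mem_image.mp hJ
      have hc := card_entrySet x i (ε i)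
      constructor
      · rw [← Finset.card_pos]
        omega
      · intro he
        have hle := Finset.card_le_card (he ▸ Finset.subset_univ I)
        have := i.isLt
        omega
    · intro J hJ L hL hne
      obtain ⟨i, -, rfl⟩ := Finset.mem_image.mp (Finset.mem_coe.mp hJ)
      obtain ⟨j, -, rfl⟩ := Finset.mem_image.mp (Finset.mem_coe.mp hL)
      rcases lt_trichotomy i j with hij | rfl | hij
      · exact Or.inl (entrySet_subset x hij _ _)
      · exact absurd rfl hne
      · exact Or.inr (entrySet_subset x hij _ _)
    · intro J hJ
      obtain ⟨i, -, rfl⟩ := Finset.mem_image.mp hJ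
      change Odd _
      rw [Finset.inter_eq_left.mpr (hsub i (ε i)), card_entrySet]
      exact ⟨i.val, rfl⟩
  · unfold facet
    rw [Finset.card_image_of_injective _ (entrySet_injective x ε)]
    simp

theorem sphereChain_mem_cycles (x : PermOn I k) :
    sphereChain x ∈ cycles (oddSubcomplex n I) ((k : ℤ) - 1) := by
  refine ⟨?_, ?_⟩
  · refine Submodule.sum_mem _ fun ε _ => ?_
    exact Finsupp.single_mem_supported ℚ _ (facet_mem x ε)
  · change boundary (sphereChain x) = 0
    unfold sphereChain
    rw [map_sum]
    have h1 : ∀ ε : Fin k → Bool,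
        boundary (Finsupp.single (facet x ε) (∏ i, if ε i then (-1 : ℚ) else 1)) =
          ∑ i : Fin k, (∏ i, if ε i then (-1 : ℚ) else 1) • Finsupp.single
            ((Finset.univ.erase i).image fun j => entrySet x (pos j (ε j)))
              ((-1 : ℚ) ^ i.val) := by
      intro ε
      rw [← Finset.smul_sum, ← boundary_facet, ← map_smul, Finsupp.smul_single, smul_eq_mul,
        mul_one]
    rw [Finset.sum_congr rfl fun ε _ => h1 ε, Finset.sum_comm]
    refine Finset.sum_eq_zero fun i _ => ?_
    refine Finset.sum_involution (fun ε _ => Function.update ε i (!ε i)) ?_ ?_ ?_ ?_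
    · intro ε _
      have h2 : ((Finset.univ.erase i).image fun j =>
            entrySet x (pos j (Function.update ε i (!ε i) j))) =
          (Finset.univ.erase i).image fun j => entrySet x (pos j (ε j)) := by
        refine Finset.image_congr fun j hj => ?_
        have hji : j ≠ i := Finset.ne_of_mem_erase (Finset.mem_coe.mp hj)
        simp [Function.update_of_ne hji]
      have h3 : (∏ j, if Function.update ε i (!ε i) j then (-1 : ℚ) else 1) =
          -∏ j, if ε j then (-1 : ℚ) else 1 := by
        rw [← Finset.mul_prod_erase Finset.univ _ (Finset.mem_univ i),
          ← Finset.mul_prod_erase Finset.univ (fun j => if ε j then (-1 : ℚ) else 1)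
            (Finset.mem_univ i), ← neg_mul]
        congr 1
        · cases ε i <;> simp
        · refine Finset.prod_congr rfl fun j hj => ?_
          rw [Function.update_of_ne (Finset.ne_of_mem_erase hj)]
      rw [h2, h3, neg_smul, add_neg_cancel]
    · intro ε _ _ he
      have := congrFun he i
      simp at this
    · intro ε _
      exact Finset.mem_univ _
    · intro ε _
      simp

/-- The homology class `[Δ_x]` in `H̃_{k-1}((K_{A_n})_I)`. -/
noncomputable def sphereClass (x : PermOn I k) :
    ReducedHomology (oddSubcomplex n I) ((k : ℤ) - 1) :=
  Submodule.Quotient.mk ⟨sphereChain x, sphereChain_mem_cycles x⟩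

/-! ### The relations and the alternating permutations -/

/-- The vector of `ℚ⟨Perm_I⟩` given by the permutation `(x_{σ(1)}x_{σ(2)}/⋯/x_{σ(2k-1)}x_{σ(2k)})`
obtained from `x` by the permutation `σ` of the positions. -/
noncomputable def vec (x : PermOn I k) (σ : Equiv.Perm (Fin (2 * k)) := 1) : PermOn I k →₀ ℚ :=
  Finsupp.single (σ.trans x) 1

/-- The sum of `x` and of the permutation obtained from `x` by exchanging the two entries of the
`i`-th block. -/
noncomputable def blockRelation (x : PermOn I k) (i : Fin k) : PermOn I k →₀ ℚ :=
  vec x + vec x (Equiv.swap (pos i false) (pos i true))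

/-- The six-term relation for the blocks `i` and `j`. If these blocks of `x` are `ab/cd`, it is
`ab/cd - ac/bd + ad/bc + bc/ad - bd/ac + cd/ab`, all other blocks being unchanged. -/
noncomputable def garnirRelation (x : PermOn I k) (i j : Fin k) : PermOn I k →₀ ℚ :=
  let a := pos i false
  let b := pos i true
  let c := pos j false
  let d := pos j true
  vec x
    - vec x (Equiv.swap b c)
    + vec x (Equiv.swap b d * Equiv.swap d c)
    + vec x (Equiv.swap a b * Equiv.swap b c)
    - vec x (Equiv.swap a b * Equiv.swap b d * Equiv.swap d c)
    + vec x (Equiv.swap a c * Equiv.swap b d)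

/-- The subspace `M_I` of `ℚ⟨Perm_I⟩`, spanned by the block relations and by the six-term relations
for consecutive blocks. -/
noncomputable def relations (I : Finset (Fin (n + 1))) (k : ℕ) : Submodule ℚ (PermOn I k →₀ ℚ) :=
  Submodule.span ℚ
    ({r | ∃ (x : PermOn I k) (i : Fin k), r = blockRelation x i} ∪
      {r | ∃ (x : PermOn I k) (i j : Fin k), j.val = i.val + 1 ∧ r = garnirRelation x i j})

/-- Alternating permutations on `I`: `x₁ < x₂ > x₃ < x₄ > ⋯ < x₂ₖ`. -/
def IsAlternating (x : PermOn I k) : Prop :=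
  ∀ j l : Fin (2 * k), l.val = j.val + 1 →
    (Even j.val → x j < x l) ∧ (Odd j.val → x l < x j)

end Permutohedral

/-!
The vertices of `(K_{A_n})_I` are the sets `J` with `|J ∩ I|` odd, and `J ↦ J ∩ I` pushes this
poset down onto the poset of odd subsets of `I`. A chain homotopy (`retractHomotopy`) makes this
precise: every cycle is homologous to one made of odd subsets of `I` (`exists_homologous_le`), and
a boundary made of odd subsets of `I` is the boundary of a chain of such
(`exists_boundary_eq_le`). The order complex of the odd subsets of `I` has dimension `k - 1`, so
the homology in question is the space of its cycles of full flags `J₁ ⊂ J₃ ⊂ ⋯ ⊂ J_{2k-1}`.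

A full flag is the flag `{x₁} ⊂ {x₁, x₂, x₃} ⊂ ⋯` of a unique permutation `x` with `x₂ > x₃`,
`x₄ > x₅`, …, and `x` is alternating exactly if also `x₁ < x₂`, `x₃ < x₄`, …. Weigh a flag by the sum
of all entries of its members. If `x_{2i-1} > x_{2i}`, then the `i`-th member is the heaviest set
that fits between its neighbours, so that the cycle condition at this member expresses the
coefficient of the flag through coefficients of lighter flags. Hence a cycle is determined by its
coefficients at the alternating flags (`eq_zero_of_alternating`). On the other hand, the flag of
an alternating `α` is the lightest facet of `Δ_α`, so that the coefficients of the cycles `Δ_α` at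
the alternating flags form a unitriangular matrix. Both facts together show that the classes
`[Δ_α]` form a basis of the homology (`linearIndependent_sphereClass`, `span_sphereClass`).

The elements of `M_I` are sent to zero already on the level of chains (`sphereChainMap_eq_zero`).
Modulo `M_I` every permutation is a combination of alternating ones: descents inside a block are
removed by the first relation, and ascents `a < b < c < d` in consecutive blocks `ab/cd` by the
second one; all other terms of it have larger entries earlier (`single_mem_sup_span_alternating`).
So the alternating permutations span the quotient and are sent to a basis, and the map is an
isomorphism.
-/

namespace Permutohedral

/-! ### Cones and the boundary operator -/

section Cone

variable {V : Type*} [PartialOrder V] [DecidableEq V] [DecidableLT V]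

/-- The operator `s ↦ ± s ∪ {w}` on chains, with the sign that turns it into a contracting homotopy
wherever `s ∪ {w}` is again a simplex; it sends the simplices that contain `w` to `0`. -/
noncomputable def cone (w : V) : (Finset V →₀ ℚ) →ₗ[ℚ] (Finset V →₀ ℚ) :=
  Finsupp.linearCombination ℚ fun s : Finset V =>
    if w ∈ s then 0
    else Finsupp.single (insert w s) ((-1 : ℚ) ^ (s.filter (fun v => v < w)).card)

theorem cone_single_of_mem {w : V} {s : Finset V} (h : w ∈ s) :
    cone w (Finsupp.single s 1) = 0 := by
  simp [cone, h]

theorem cone_single_of_notMem {w : V} {s : Finset V} (h : w ∉ s) :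
    cone w (Finsupp.single s 1) =
      Finsupp.single (insert w s) ((-1 : ℚ) ^ (s.filter (fun v => v < w)).card) := by
  simp [cone, h]

theorem boundary_single (s : Finset V) :
    boundary (Finsupp.single s (1 : ℚ)) =
      ∑ v ∈ s, (-1 : ℚ) ^ (s.filter (fun w => w < v)).card • Finsupp.single (s.erase v) 1 := by
  simp [boundary]

/-- A linear map sends combinations of simplices in `S` into `M` if it does so with every simplex
in `S`. -/
theorem map_mem_of_mem_supported {α M : Type*} [AddCommGroup M] [Module ℚ M]
    (φ : (α →₀ ℚ) →ₗ[ℚ] M) {S : Set α} {N : Submodule ℚ M}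
    (h : ∀ s ∈ S, φ (Finsupp.single s 1) ∈ N) {c : α →₀ ℚ} (hc : c ∈ Finsupp.supported ℚ ℚ S) :
    φ c ∈ N := by
  rw [Finsupp.supported_eq_span_single] at hc
  have : Submodule.span ℚ ((fun i => Finsupp.single i (1 : ℚ)) '' S) ≤ N.comap φ := by
    rw [Submodule.span_le]
    rintro _ ⟨s, hs, rfl⟩
    exact h s hs
  exact this hc

theorem boundary_single_mem_supported {S : Set (Finset V)} {s : Finset V}
    (h : ∀ v ∈ s, s.erase v ∈ S) :
    boundary (Finsupp.single s (1 : ℚ)) ∈ Finsupp.supported ℚ ℚ S := by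
  rw [boundary_single]
  exact Submodule.sum_mem _ fun v hv =>
    Submodule.smul_mem _ _ (Finsupp.single_mem_supported ℚ _ (h v hv))

theorem cone_single_mem_supported {S : Set (Finset V)} {w : V} {s : Finset V}
    (h : w ∉ s → insert w s ∈ S) :
    cone w (Finsupp.single s (1 : ℚ)) ∈ Finsupp.supported ℚ ℚ S := by
  by_cases hw : w ∈ s
  · rw [cone_single_of_mem hw]
    exact Submodule.zero_mem _
  · rw [cone_single_of_notMem hw]
    exact Finsupp.single_mem_supported ℚ _ (h hw)

theorem boundary_cone_single {w : V} {s : Finset V}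
    (hs : IsChain (· ≤ ·) ((insert w s : Finset V) : Set V)) :
    boundary (cone w (Finsupp.single s 1)) + cone w (boundary (Finsupp.single s 1)) =
      Finsupp.single s 1 := by
  by_cases hw : w ∈ s
  · rw [cone_single_of_mem hw, map_zero, zero_add, boundary_single, map_sum,
      Finset.sum_eq_single_of_mem w hw]
    · rw [map_smul, cone_single_of_notMem (Finset.notMem_erase w s), Finset.insert_erase hw,
        Finsupp.smul_single, smul_eq_mul]
      have : (s.erase w).filter (fun v => v < w) = s.filter (fun v => v < w) := by
        ext v
        simp only [Finset.mem_filter, Finset.mem_erase]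
        exact ⟨fun h => ⟨h.1.2, h.2⟩, fun h => ⟨⟨h.2.ne, h.1⟩, h.2⟩⟩
      rw [this, ← mul_pow]
      simp
    · intro v _ hvw
      rw [map_smul, cone_single_of_mem (Finset.mem_erase.mpr ⟨hvw.symm, hw⟩), smul_zero]
  · have h1 : Finsupp.single (insert w s) ((-1 : ℚ) ^ (s.filter (fun v => v < w)).card) =
        (-1 : ℚ) ^ (s.filter (fun v => v < w)).card • Finsupp.single (insert w s) 1 := by simp
    have h2 : (insert w s).filter (fun v => v < w) = s.filter (fun v => v < w) := by
      simp [Finset.filter_insert]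
    rw [cone_single_of_notMem hw, h1, map_smul, boundary_single, Finset.sum_insert hw, h2,
      Finset.erase_insert hw, smul_add, smul_smul, ← mul_pow, neg_one_mul, neg_neg, one_pow,
      one_smul, add_assoc, add_eq_left, boundary_single, map_sum, Finset.smul_sum,
      ← Finset.sum_add_distrib]
    refine Finset.sum_eq_zero fun v hv => ?_
    have hvw : v ≠ w := fun h => hw (h ▸ hv)
    have hw' : w ∉ s.erase v := fun h => hw (Finset.mem_of_mem_erase h)
    rw [map_smul, cone_single_of_notMem hw', Finset.erase_insert_of_ne hvw.symm,
      Finsupp.smul_single, Finsupp.smul_single, Finsupp.smul_single, ← Finsupp.single_add]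
    rw [Finsupp.single_eq_zero]
    have hch : v ≤ w ∨ w ≤ v := by
      refine hs.total ?_ ?_ <;> simp [hv]
    -- Exactly one of `v < w` and `w < v` holds, and it changes exactly one of the two signs.
    rcases hch with h | h
    · have hlt : v < w := lt_of_le_of_ne h hvw
      have h3 : (insert w s).filter (fun u => u < v) = s.filter (fun u => u < v) := by
        rw [Finset.filter_insert, if_neg hlt.not_gt]
      have h4 : ((s.erase v).filter (fun u => u < w)).card + 1 =
          (s.filter (fun u => u < w)).card := by
        rw [Finset.filter_erase, Finset.card_erase_add_one]
        simp [hv, hlt]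
      rw [h3, ← h4, pow_succ]
      simp only [smul_eq_mul]
      ring
    · have hlt : w < v := lt_of_le_of_ne h hvw.symm
      have h3 : ((insert w s).filter (fun u => u < v)).card =
          (s.filter (fun u => u < v)).card + 1 := by
        rw [Finset.filter_insert, if_pos hlt, Finset.card_insert_of_notMem]
        simp [hw]
      have h4 : (s.erase v).filter (fun u => u < w) = s.filter (fun u => u < w) := by
        rw [Finset.filter_erase, Finset.erase_eq_of_notMem]
        simp [hlt.not_gt]
      rw [h3, h4, pow_succ]
      simp only [smul_eq_mul]
      ring

theorem boundary_cone {w : V} {c : Finset V →₀ ℚ}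
    (hc : c ∈ Finsupp.supported ℚ ℚ
      {s : Finset V | IsChain (· ≤ ·) ((insert w s : Finset V) : Set V)}) :
    boundary (cone w c) + cone w (boundary c) = c := by
  have := map_mem_of_mem_supported (N := ⊥)
    (boundary ∘ₗ cone w + cone w ∘ₗ boundary - LinearMap.id)
    (fun s hs => by
      rw [Submodule.mem_bot]
      simpa [sub_eq_zero] using boundary_cone_single hs) hc
  rw [Submodule.mem_bot] at this
  simpa [sub_eq_zero] using this

/-- `∂ ∘ ∂ = 0` on a simplex: a simplex is a cone over the opposite face of any of its vertices. -/
theorem boundary_boundary_single (s : Finset V) (hs : IsChain (· ≤ ·) (s : Set V)) :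
    boundary (boundary (Finsupp.single s (1 : ℚ))) = 0 := by
  induction s using Finset.induction_on with
  | empty => simp [boundary_single]
  | insert w s hw ih =>
    have hs' : IsChain (· ≤ ·) (s : Set V) := hs.mono (by simp)
    have h1 : Finsupp.single (insert w s) (1 : ℚ) =
        (-1 : ℚ) ^ (s.filter (fun v => v < w)).card • cone w (Finsupp.single s 1) := by
      rw [cone_single_of_notMem hw, Finsupp.smul_single, smul_eq_mul, ← mul_pow]
      simp
    have h2 : boundary (cone w (boundary (Finsupp.single s (1 : ℚ)))) =
        boundary (Finsupp.single s 1) := by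
      have := boundary_cone (w := w) (c := boundary (Finsupp.single s (1 : ℚ)))
        (boundary_single_mem_supported fun v _ => hs.mono (by
          rw [Finset.coe_subset]
          exact Finset.insert_subset_insert _ (Finset.erase_subset _ _)))
      rwa [ih hs', map_zero, add_zero] at this
    rw [h1, map_smul, map_smul, eq_sub_of_add_eq (boundary_cone_single hs), map_sub, h2, sub_self,
      smul_zero]

end Cone

/-! ### Retraction of an order complex onto the part below an element -/

section Retraction

open Classical in
/-- The simplices of the order complex of `W` (together with the empty simplex) that have `p`
vertices, at most `m` of which do not lie below `c`. -/
def simplicesWithin {V : Type*} [PartialOrder V] (W : Set V) (c : V) (p : ℤ) (m : ℕ) :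
    Set (Finset V) :=
  {s | (∀ v ∈ s, v ∈ W) ∧ IsChain (· ≤ ·) (s : Set V) ∧ (s.card : ℤ) = p ∧
    (s.filter fun v => ¬ v ≤ c).card ≤ m}

theorem simplicesWithin_mono {V : Type*} [PartialOrder V] (W : Set V) (c : V) (p : ℤ) {m m' : ℕ}
    (h : m ≤ m') : simplicesWithin W c p m ⊆ simplicesWithin W c p m' :=
  fun _ hs => ⟨hs.1, hs.2.1, hs.2.2.1, hs.2.2.2.trans h⟩

theorem mem_simplicesWithin_zero_iff {V : Type*} [PartialOrder V] {W : Set V} {c : V} {p : ℤ}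
    {s : Finset V} : s ∈ simplicesWithin W c p 0 ↔
      (∀ v ∈ s, v ∈ W) ∧ IsChain (· ≤ ·) (s : Set V) ∧ (s.card : ℤ) = p ∧ ∀ v ∈ s, v ≤ c := by
  classical
  simp [simplicesWithin, Finset.filter_eq_empty_iff]

theorem mem_simplicesWithin_toNat {V : Type*} [PartialOrder V] {W : Set V} (c : V) {p : ℤ}
    {s : Finset V} (hW : ∀ v ∈ s, v ∈ W) (hs : IsChain (· ≤ ·) (s : Set V))
    (hp : (s.card : ℤ) = p) : s ∈ simplicesWithin W c p p.toNat := by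
  classical
  exact ⟨hW, hs, hp, (Finset.card_le_card (Finset.filter_subset _ _)).trans (by omega)⟩

theorem erase_mem_simplicesWithin {V : Type*} [PartialOrder V] [DecidableEq V] {W : Set V} {c : V}
    {p : ℤ} {m : ℕ} {s : Finset V} (hs : s ∈ simplicesWithin W c p m) {v : V} (hv : v ∈ s) :
    s.erase v ∈ simplicesWithin W c (p - 1) m := by
  classical
  refine ⟨fun u hu => hs.1 u (Finset.mem_of_mem_erase hu),
    hs.2.1.mono (Finset.coe_subset.mpr (Finset.erase_subset _ _)), ?_,
    (Finset.card_le_card (Finset.filter_subset_filter _ (Finset.erase_subset _ _))).trans hs.2.2.2⟩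
  have := Finset.card_erase_add_one hv
  have := hs.2.2.1
  omega

/-- A simplex has a lowest vertex not below `c`, unless all its vertices lie below `c`. -/
theorem exists_isLeast_not_le {V : Type*} [PartialOrder V] {c : V} {s : Finset V}
    (hs : IsChain (· ≤ ·) (s : Set V)) :
    (∀ v ∈ s, v ≤ c) ∨ ∃ b, IsLeast {v | v ∈ s ∧ ¬ v ≤ c} b := by
  classical
  by_cases h : ∀ v ∈ s, v ≤ c
  · exact Or.inl h
  · right
    push Not at h
    obtain ⟨a, ha, hac⟩ := h
    obtain ⟨b, hb, hmin⟩ := (s.filter fun v => ¬ v ≤ c).exists_minimal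
      ⟨a, Finset.mem_filter.mpr ⟨ha, hac⟩⟩
    rw [Finset.mem_filter] at hb
    refine ⟨b, hb, fun v hv => ?_⟩
    rcases hs.total hb.1 hv.1 with h | h
    · exact h
    · exact hmin (Finset.mem_filter.mpr hv) h

theorem isChain_insert_inf {V : Type*} [SemilatticeInf V] [DecidableEq V] {c b : V}
    {s : Finset V} (hs : IsChain (· ≤ ·) (s : Set V))
    (hb : IsLeast {v | v ∈ s ∧ ¬ v ≤ c} b) :
    IsChain (· ≤ ·) ((insert (b ⊓ c) s : Finset V) : Set V) := by
  rw [Finset.coe_insert]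
  refine hs.insert fun v hv _ => ?_
  by_cases hvc : v ≤ c
  · right
    refine le_inf ?_ hvc
    rcases hs.total hb.1.1 hv with h | h
    · exact absurd (h.trans hvc) hb.1.2
    · exact h
  · exact Or.inl (inf_le_left.trans (hb.2 ⟨hv, hvc⟩))

theorem insert_inf_mem_simplicesWithin {V : Type*} [SemilatticeInf V] [DecidableEq V]
    {W : Set V} {c : V} (hW : ∀ v ∈ W, v ⊓ c ∈ W) {p : ℤ}
    {m : ℕ} {s : Finset V} (hs : s ∈ simplicesWithin W c p m) {b : V}
    (hb : IsLeast {v | v ∈ s ∧ ¬ v ≤ c} b) (hbs : b ⊓ c ∉ s) :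
    insert (b ⊓ c) s ∈ simplicesWithin W c (p + 1) m := by
  classical
  refine ⟨?_, isChain_insert_inf hs.2.1 hb, ?_, ?_⟩
  · intro v hv
    rcases Finset.mem_insert.mp hv with rfl | hv
    · exact hW b (hs.1 b hb.1.1)
    · exact hs.1 v hv
  · rw [Finset.card_insert_of_notMem hbs, ← hs.2.2.1]
    push_cast
    rfl
  · rw [Finset.filter_insert, if_neg (by simp)]
    exact hs.2.2.2

variable {V : Type*} [SemilatticeInf V] [DecidableEq V] [DecidableLT V]

open Classical in
/-- The chain homotopy that inserts `b ⊓ c` into a simplex whose lowest vertex not below `c` is `b`.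
It vanishes on the simplices all of whose vertices lie below `c`. -/
noncomputable def retractHomotopy (c : V) : (Finset V →₀ ℚ) →ₗ[ℚ] (Finset V →₀ ℚ) :=
  Finsupp.linearCombination ℚ fun s : Finset V =>
    if h : ∃ b, IsLeast {v | v ∈ s ∧ ¬ v ≤ c} b then cone (h.choose ⊓ c) (Finsupp.single s 1) else 0

theorem retractHomotopy_single {c b : V} {s : Finset V} (h : IsLeast {v | v ∈ s ∧ ¬ v ≤ c} b) :
    retractHomotopy c (Finsupp.single s 1) = cone (b ⊓ c) (Finsupp.single s 1) := by
  have h' : ∃ b, IsLeast {v | v ∈ s ∧ ¬ v ≤ c} b := ⟨b, h⟩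
  rw [retractHomotopy, Finsupp.linearCombination_single, one_smul, dif_pos h',
    h'.choose_spec.unique h]

theorem retractHomotopy_single_of_le {c : V} {s : Finset V} (h : ∀ v ∈ s, v ≤ c) :
    retractHomotopy c (Finsupp.single s 1) = 0 := by
  rw [retractHomotopy, Finsupp.linearCombination_single, one_smul, dif_neg]
  rintro ⟨b, hb, -⟩
  exact hb.2 (h b hb.1)

theorem retractHomotopy_mem {W : Set V} {c : V} (hW : ∀ v ∈ W, v ⊓ c ∈ W) {p : ℤ} {m : ℕ}
    {z : Finset V →₀ ℚ} (hz : z ∈ Finsupp.supported ℚ ℚ (simplicesWithin W c p m)) :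
    retractHomotopy c z ∈ Finsupp.supported ℚ ℚ (simplicesWithin W c (p + 1) m) := by
  refine map_mem_of_mem_supported _ (fun s hs => ?_) hz
  rcases exists_isLeast_not_le (c := c) hs.2.1 with h | ⟨b, hb⟩
  · rw [retractHomotopy_single_of_le h]
    exact Submodule.zero_mem _
  · rw [retractHomotopy_single hb]
    exact cone_single_mem_supported fun hbs => insert_inf_mem_simplicesWithin hW hs hb hbs

/-- `id - ∂h - h∂`, for `h` the homotopy `retractHomotopy`, pushes the simplices towards the part of
the complex below `c`: in `h ∂ s` only the face without the lowest vertex `b` not below `c` is not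
coned off with the apex `b ⊓ c`, and this face has fewer vertices not below `c`. -/
theorem sub_homotopy_mem {W : Set V} {c : V} (hW : ∀ v ∈ W, v ⊓ c ∈ W) {p : ℤ} {m : ℕ}
    {z : Finset V →₀ ℚ} (hz : z ∈ Finsupp.supported ℚ ℚ (simplicesWithin W c p (m + 1))) :
    z - boundary (retractHomotopy c z) - retractHomotopy c (boundary z) ∈
      Finsupp.supported ℚ ℚ (simplicesWithin W c p m) := by
  classical
  refine map_mem_of_mem_supported
    (LinearMap.id - boundary ∘ₗ retractHomotopy c - retractHomotopy c ∘ₗ boundary)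
    (fun s hs => ?_) hz
  simp only [LinearMap.sub_apply, LinearMap.id_apply, LinearMap.comp_apply]
  rcases exists_isLeast_not_le (c := c) hs.2.1 with h | ⟨b, hb⟩
  · have h0 : retractHomotopy c (boundary (Finsupp.single s 1)) = 0 := by
      rw [boundary_single, map_sum]
      refine Finset.sum_eq_zero fun v _ => ?_
      rw [map_smul, retractHomotopy_single_of_le fun u hu => h u (Finset.mem_of_mem_erase hu),
        smul_zero]
    rw [retractHomotopy_single_of_le h, map_zero, sub_zero, h0, sub_zero]
    refine Finsupp.single_mem_supported ℚ _ ⟨hs.1, hs.2.1, hs.2.2.1, ?_⟩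
    rw [Finset.filter_false_of_mem (by simpa using h)]
    simp
  · have hlow : s.erase b ∈ simplicesWithin W c (p - 1) m := by
      obtain ⟨h1, h2, h3, -⟩ := erase_mem_simplicesWithin hs hb.1.1
      refine ⟨h1, h2, h3, ?_⟩
      have h4 : b ∈ s.filter fun v => ¬ v ≤ c := Finset.mem_filter.mpr hb.1
      have := Finset.card_erase_add_one h4
      rw [Finset.filter_erase]
      have := hs.2.2.2
      omega
    rw [retractHomotopy_single hb,
      eq_sub_of_add_eq (boundary_cone_single (isChain_insert_inf hs.2.1 hb)), sub_sub_cancel,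
      boundary_single, map_sum, map_sum, ← Finset.sum_sub_distrib,
      Finset.sum_eq_single_of_mem b hb.1.1]
    · rw [map_smul, map_smul, ← smul_sub]
      refine Submodule.smul_mem _ _ (Submodule.sub_mem _ ?_ ?_)
      · refine cone_single_mem_supported fun hbs => ?_
        have hch := isChain_insert_inf hs.2.1 hb
        refine ⟨?_, hch.mono (Finset.coe_subset.mpr
          (Finset.insert_subset_insert _ (Finset.erase_subset _ _))), ?_, ?_⟩
        · intro v hv
          rcases Finset.mem_insert.mp hv with rfl | hv
          · exact hW b (hs.1 b hb.1.1)
          · exact hlow.1 v hv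
        · rw [Finset.card_insert_of_notMem hbs]
          have := hlow.2.2.1
          push_cast
          omega
        · rw [Finset.filter_insert, if_neg (by simp)]
          exact hlow.2.2.2
      · have := retractHomotopy_mem hW (Finsupp.single_mem_supported ℚ (1 : ℚ) hlow)
        rwa [sub_add_cancel] at this
    · intro v hv hvb
      have hb' : IsLeast {u | u ∈ s.erase v ∧ ¬ u ≤ c} b :=
        ⟨⟨Finset.mem_erase.mpr ⟨hvb.symm, hb.1.1⟩, hb.1.2⟩,
          fun u hu => hb.2 ⟨Finset.mem_of_mem_erase hu.1, hu.2⟩⟩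
      rw [map_smul, map_smul, retractHomotopy_single hb', sub_self]

theorem boundary_boundary {W : Set V} {c : V} {p : ℤ} {m : ℕ} {z : Finset V →₀ ℚ}
    (hz : z ∈ Finsupp.supported ℚ ℚ (simplicesWithin W c p m)) : boundary (boundary z) = 0 := by
  have := map_mem_of_mem_supported (N := ⊥) (boundary ∘ₗ boundary)
    (fun s hs => by
      rw [Submodule.mem_bot]
      exact boundary_boundary_single s hs.2.1) hz
  simpa using this

/-- Every cycle is homologous to a cycle in the part of the complex below `c`. -/
theorem exists_homologous_le {W : Set V} {c : V} (hW : ∀ v ∈ W, v ⊓ c ∈ W) {p : ℤ} (m : ℕ)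
    {z : Finset V →₀ ℚ} (hz : z ∈ Finsupp.supported ℚ ℚ (simplicesWithin W c p m))
    (hz0 : boundary z = 0) :
    ∃ z' ∈ Finsupp.supported ℚ ℚ (simplicesWithin W c p 0), boundary z' = 0 ∧
      ∃ m', ∃ y ∈ Finsupp.supported ℚ ℚ (simplicesWithin W c (p + 1) m'), z - z' = boundary y := by
  induction m generalizing z with
  | zero => exact ⟨z, hz, hz0, 0, 0, Submodule.zero_mem _, by simp⟩
  | succ m ih =>
    have h1 := sub_homotopy_mem hW hz
    rw [hz0, map_zero, sub_zero] at h1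
    have h2 := retractHomotopy_mem hW hz
    obtain ⟨z', h3, h4, m', y, hy, h5⟩ := ih h1 (by
      rw [map_sub, hz0, boundary_boundary h2, sub_zero])
    refine ⟨z', h3, h4, max m' (m + 1), y + retractHomotopy c z, ?_, ?_⟩
    · exact Submodule.add_mem _
        (Finsupp.supported_mono (simplicesWithin_mono W c _ (le_max_left _ _)) hy)
        (Finsupp.supported_mono (simplicesWithin_mono W c _ (le_max_right _ _)) h2)
    · rw [map_add, ← h5]
      abel

/-- A boundary that lies in the part of the complex below `c` is a boundary in that part. -/
theorem exists_boundary_eq_le {W : Set V} {c : V} (hW : ∀ v ∈ W, v ⊓ c ∈ W) {p : ℤ} (m : ℕ)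
    {z y : Finset V →₀ ℚ} (hz : z ∈ Finsupp.supported ℚ ℚ (simplicesWithin W c p 0))
    (hy : y ∈ Finsupp.supported ℚ ℚ (simplicesWithin W c (p + 1) m)) (h : boundary y = z) :
    ∃ y' ∈ Finsupp.supported ℚ ℚ (simplicesWithin W c (p + 1) 0), boundary y' = z := by
  induction m generalizing y with
  | zero => exact ⟨y, hy, h⟩
  | succ m ih =>
    have hz0 : retractHomotopy c z = 0 := by
      have := map_mem_of_mem_supported (N := ⊥) (retractHomotopy c) (fun s hs => by
        rw [Submodule.mem_bot]
        exact retractHomotopy_single_of_le (mem_simplicesWithin_zero_iff.mp hs).2.2.2) hz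
      simpa using this
    have h1 := sub_homotopy_mem hW hy
    rw [h, hz0, sub_zero] at h1
    exact ih h1 (by rw [map_sub, boundary_boundary (retractHomotopy_mem hW hy), sub_zero, h])

end Retraction

/-! ### Full flags of odd subsets and permutations -/

section Flags

variable {n k : ℕ} {I : Finset (Fin (n + 1))}

/-- Full flags of odd subsets of `I`. As `|I| = 2k`, the subsets have `1, 3, …, 2k - 1` elements. -/
def IsFlag (I : Finset (Fin (n + 1))) (k : ℕ) (s : Finset (Finset (Fin (n + 1)))) : Prop :=
  (∀ J ∈ s, J ⊆ I ∧ Odd J.card) ∧ IsChain (· ⊆ ·) (s : Set (Finset (Fin (n + 1)))) ∧ s.card = k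

/-- The flag `{x₁} ⊂ {x₁, x₂, x₃} ⊂ ⋯`, as a facet of `Δ_x`. -/
abbrev flagOf (x : PermOn I k) : Finset (Finset (Fin (n + 1))) := facet x fun _ => false

/-- Each two-element step of the flag of `x` is listed in decreasing order: `x₂ > x₃`, `x₄ > x₅`,
and so on. -/
def IsFlagSorted (x : PermOn I k) : Prop :=
  ∀ j l : Fin (2 * k), l.val = j.val + 1 → Odd j.val → x l < x j

theorem mem_entrySet_false (x : PermOn I k) (i : Fin k) (l : Fin (2 * k)) :
    (x l : Fin (n + 1)) ∈ entrySet x (pos i false) ↔ l.val ≤ 2 * i.val := by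
  rw [mem_entrySet]
  constructor
  · rintro ⟨l', h, he⟩
    obtain rfl := x.injective (Subtype.ext he)
    rcases h with h | rfl
    · omega
    · simp [pos]
  · intro h
    refine ⟨l, ?_, rfl⟩
    rcases h.lt_or_eq with h | h
    · exact Or.inl h
    · exact Or.inr (Fin.ext (by simp [pos, h]))

theorem entrySet_subset_self (x : PermOn I k) (j : Fin (2 * k)) : entrySet x j ⊆ I := by
  intro a ha
  obtain ⟨l, -, rfl⟩ := Finset.mem_image.mp ha
  exact (x l).2

theorem card_facet (x : PermOn I k) (ε : Fin k → Bool) : (facet x ε).card = k := by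
  have := (facet_mem x ε).2
  omega

theorem mem_facet {x : PermOn I k} {ε : Fin k → Bool} {J : Finset (Fin (n + 1))} :
    J ∈ facet x ε ↔ ∃ i, entrySet x (pos i (ε i)) = J := by
  simp [facet]

theorem isFlag_facet (x : PermOn I k) (ε : Fin k → Bool) : IsFlag I k (facet x ε) := by
  refine ⟨?_, ?_, card_facet x ε⟩
  · intro J hJ
    obtain ⟨i, rfl⟩ := mem_facet.mp hJ
    exact ⟨entrySet_subset_self x _, card_entrySet x i _ ▸ ⟨i.val, rfl⟩⟩
  · rcases (facet_mem x ε).1 with h | h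
    · simp [h]
    · exact h.1.2.2

/-- Sorting the elements of `I` by this key lists them in the order in which they appear in the flag
`s`, and elements that appear together in decreasing order. -/
def flagKey (s : Finset (Finset (Fin (n + 1)))) (a : I) : ℕ ×ₗ Iᵒᵈ :=
  toLex ((s.filter fun J => (a : Fin (n + 1)) ∉ J).card, OrderDual.toDual a)

theorem flagKey_injective (s : Finset (Finset (Fin (n + 1)))) :
    Function.Injective (flagKey (I := I) s) := by
  intro a b h
  exact (by simpa [flagKey] using h : _ ∧ a = b).2

theorem strictMono_flagKey {x : PermOn I k} (hx : IsFlagSorted x) :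
    StrictMono (flagKey (flagOf x) ∘ x) := by
  intro l l' hll
  have hsub : ((flagOf x).filter fun J => (x l : Fin (n + 1)) ∉ J) ⊆
      (flagOf x).filter fun J => (x l' : Fin (n + 1)) ∉ J := by
    refine Finset.monotone_filter_right _ fun J hJ hJl => ?_
    obtain ⟨i, rfl⟩ := mem_facet.mp hJ
    rw [mem_entrySet_false] at hJl ⊢
    have := Fin.lt_def.mp hll
    omega
  simp only [Function.comp_apply, flagKey, Prod.Lex.toLex_lt_toLex]
  by_cases h : Odd l.val ∧ l'.val = l.val + 1
  · rcases (Finset.card_le_card hsub).lt_or_eq with h' | h'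
    · exact Or.inl h'
    · exact Or.inr ⟨h', OrderDual.toDual_lt_toDual.mpr (hx l l' h.2 h.1)⟩
  · left
    refine Finset.card_lt_card ⟨hsub, fun hle => ?_⟩
    have hlt := Fin.lt_def.mp hll
    have hi : (l.val + 1) / 2 < k := by have := l'.isLt; omega
    have hm : entrySet x (pos ⟨(l.val + 1) / 2, hi⟩ false) ∈ flagOf x := mem_facet.mpr ⟨_, rfl⟩
    have h2 := hle (Finset.mem_filter.mpr ⟨hm, by
      rw [mem_entrySet_false]
      simp only
      intro hle
      rcases Nat.even_or_odd' l.val with ⟨c, hc | hc⟩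
      · omega
      · exact h ⟨⟨c, hc⟩, by omega⟩⟩)
    have h3 := (Finset.mem_filter.mp h2).2
    rw [mem_entrySet_false] at h3
    simp only at h3
    omega

theorem flagOf_injective {x y : PermOn I k} (hx : IsFlagSorted x) (hy : IsFlagSorted y)
    (h : flagOf x = flagOf y) : x = y := by
  have h1 := strictMono_flagKey hx
  have h2 := strictMono_flagKey hy
  rw [← h] at h2
  have h3 := (h1.range_inj h2).mp (by
    rw [x.surjective.range_comp, y.surjective.range_comp])
  exact Equiv.ext fun l => flagKey_injective _ (congrFun h3 l)

theorem mem_iff_val_lt_card {m : ℕ} {A : Finset (Fin m)} (hA : IsLowerSet (A : Set (Fin m)))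
    (l : Fin m) : l ∈ A ↔ l.val < A.card := by
  constructor
  · intro h
    have : Finset.Iic l ⊆ A := fun l' hl' => hA (Finset.mem_Iic.mp hl') h
    have := Finset.card_le_card this
    rw [Fin.card_Iic] at this
    omega
  · intro h
    by_contra hl
    have : A ⊆ Finset.Iio l := fun l' hl' =>
      Finset.mem_Iio.mpr (lt_of_not_ge fun hle => hl (hA hle hl'))
    have := Finset.card_le_card this
    rw [Fin.card_Iio] at this
    omega

/-- Every full flag of odd subsets is the flag of a sorted permutation. -/
theorem exists_flagOf_eq (hI : I.card = 2 * k) {s : Finset (Finset (Fin (n + 1)))}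
    (hs : IsFlag I k s) : ∃ x : PermOn I k, IsFlagSorted x ∧ flagOf x = s := by
  let x₀ : PermOn I k := (Fintype.equivFinOfCardEq (by simpa using hI)).symm
  let x : PermOn I k := (Tuple.sort (flagKey s ∘ x₀)).trans x₀
  have hmono : StrictMono (flagKey s ∘ x) :=
    (Tuple.monotone_sort (flagKey s ∘ x₀)).strictMono_of_injective
      ((flagKey_injective s).comp x.injective)
  have hmem : ∀ J ∈ s, ∀ l, (x l : Fin (n + 1)) ∈ J ↔ l.val < J.card := by
    intro J hJ l
    have hlow : IsLowerSet
        ((Finset.univ.filter fun l => (x l : Fin (n + 1)) ∈ J : Finset (Fin (2 * k))) :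
          Set (Fin (2 * k))) := by
      intro l l' hle hl
      simp only [Finset.coe_filter, Finset.mem_univ, true_and, Set.mem_ofPred_eq] at hl ⊢
      by_contra hl'
      -- The members of the flag without `x l` are strictly fewer than those without `x l'`.
      have hlt : (s.filter fun J => (x l : Fin (n + 1)) ∉ J).card <
          (s.filter fun J => (x l' : Fin (n + 1)) ∉ J).card := by
        refine Finset.card_lt_card ⟨?_, fun h => ?_⟩
        · refine Finset.monotone_filter_right _ fun J' hJ' h h' => ?_
          rcases hs.2.1.total hJ hJ' with hc | hc
          · exact h (hc hl)
          · exact hl' (hc h')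
        · exact (Finset.mem_filter.mp (h (Finset.mem_filter.mpr ⟨hJ, hl'⟩))).2 hl
      have hle' := hmono.monotone hle
      simp only [Function.comp_apply, flagKey, Prod.Lex.toLex_le_toLex] at hle'
      omega
    have hcard : (Finset.univ.filter fun l => (x l : Fin (n + 1)) ∈ J).card = J.card := by
      rw [← Finset.card_image_of_injective _ (Subtype.val_injective.comp x.injective)]
      congr 1
      ext a
      simp only [Finset.mem_image, Finset.mem_filter, Finset.mem_univ, true_and,
        Function.comp_apply]
      constructor
      · rintro ⟨l, h, rfl⟩
        exact h
      · intro ha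
        exact ⟨x.symm ⟨a, (hs.1 J hJ).1 ha⟩, by simpa using ha, by simp⟩
    rw [← hcard, ← mem_iff_val_lt_card hlow]
    simp
  refine ⟨x, ?_, (Finset.eq_of_subset_of_card_le ?_ ?_).symm⟩
  · intro j l hl hj
    have hlt := hmono (Fin.lt_def.mpr (by omega) : j < l)
    have heq : (s.filter fun J => (x j : Fin (n + 1)) ∉ J) =
        s.filter fun J => (x l : Fin (n + 1)) ∉ J := by
      refine Finset.filter_congr fun J hJ => ?_
      rw [hmem J hJ, hmem J hJ]
      obtain ⟨c, hc⟩ := (hs.1 J hJ).2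
      obtain ⟨d, hd⟩ := hj
      omega
    simp only [Function.comp_apply, flagKey, Prod.Lex.toLex_lt_toLex, heq, lt_irrefl, false_or,
      true_and] at hlt
    exact OrderDual.toDual_lt_toDual.mp hlt
  · intro J hJ
    obtain ⟨c, hc⟩ := (hs.1 J hJ).2
    have hle := Finset.card_le_card (hs.1 J hJ).1
    refine mem_facet.mpr ⟨⟨c, by omega⟩, ?_⟩
    ext a
    constructor
    · intro ha
      obtain ⟨l, rfl⟩ : ∃ l, (x l : Fin (n + 1)) = a :=
        ⟨x.symm ⟨a, entrySet_subset_self x _ ha⟩, by simp⟩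
      rw [mem_entrySet_false] at ha
      rw [hmem J hJ]
      simp only at ha
      omega
    · intro ha
      obtain ⟨l, rfl⟩ : ∃ l, (x l : Fin (n + 1)) = a :=
        ⟨x.symm ⟨a, (hs.1 J hJ).1 ha⟩, by simp⟩
      rw [hmem J hJ] at ha
      rw [mem_entrySet_false]
      simp only
      omega
  · rw [card_facet, hs.2.2]

/-- The sum of all entries of all members of `s`. -/
def flagWeight (s : Finset (Finset (Fin (n + 1)))) : ℕ := ∑ J ∈ s, ∑ a ∈ J, a.val

theorem sum_entrySet (x : PermOn I k) (i : Fin k) (b : Bool) :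
    ∑ a ∈ entrySet x (pos i b), a.val =
      (∑ l : Fin (2 * k) with l.val < 2 * i.val, (x l : Fin (n + 1)).val) +
        (x (pos i b) : Fin (n + 1)).val := by
  have h : 2 * ((pos i b).val / 2) = 2 * i.val := by
    have := b.toNat_le
    simp only [pos]
    omega
  unfold entrySet
  rw [Finset.sum_image (fun l _ l' _ h => x.injective (Subtype.ext h)), h, Finset.filter_or,
    Finset.sum_union]
  · rw [Finset.filter_eq' Finset.univ (pos i b)]
    simp
  · rw [Finset.disjoint_left]
    intro l hl hl'
    simp only [Finset.mem_filter, Finset.mem_univ, true_and] at hl hl'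
    subst hl'
    simp only [pos] at hl
    omega

theorem flagWeight_facet (x : PermOn I k) (ε : Fin k → Bool) :
    flagWeight (facet x ε) = ∑ i, ((∑ l : Fin (2 * k) with l.val < 2 * i.val,
      (x l : Fin (n + 1)).val) + (x (pos i (ε i)) : Fin (n + 1)).val) := by
  rw [flagWeight, facet, Finset.sum_image fun i _ j _ h => entrySet_injective x ε h]
  exact Finset.sum_congr rfl fun i _ => sum_entrySet x i (ε i)

/-- If all blocks of `x` are increasing, the flag of `x` is the facet of `Δ_x` of least weight. -/
theorem flagWeight_flagOf_lt {x : PermOn I k} (hx : ∀ i, x (pos i false) < x (pos i true))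
    {ε : Fin k → Bool} (hε : ε ≠ fun _ => false) :
    flagWeight (flagOf x) < flagWeight (facet x ε) := by
  rw [flagWeight_facet, flagWeight_facet]
  obtain ⟨i, hi⟩ := Function.ne_iff.mp hε
  refine Finset.sum_lt_sum (fun j _ => ?_) ⟨i, Finset.mem_univ i, ?_⟩
  · have h : (x (pos j false) : Fin (n + 1)).val < (x (pos j true) : Fin (n + 1)).val := hx j
    cases ε j <;> omega
  · have h : (x (pos i false) : Fin (n + 1)).val < (x (pos i true) : Fin (n + 1)).val := hx i
    simp only [ne_eq, Bool.not_eq_false] at hi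
    rw [hi]
    omega

theorem sum_lt_sum_of_threshold {α : Type*} [DecidableEq α] {A B : Finset α} (f : α → ℕ) (m : ℕ)
    (hcard : A.card = B.card) (hne : A ≠ B) (hA : ∀ a ∈ A, a ∉ B → f a ≤ m)
    (hB : ∀ b ∈ B, b ∉ A → m < f b) : ∑ a ∈ A, f a < ∑ b ∈ B, f b := by
  have h1 : (A \ B).card = (B \ A).card := Finset.card_sdiff_comm hcard
  have h2 : 0 < (B \ A).card := by
    rw [Finset.card_pos, Finset.sdiff_nonempty]
    intro h
    exact hne (Finset.eq_of_subset_of_card_le h hcard.le).symm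
  have h3 : ∑ a ∈ A \ B, f a ≤ (A \ B).card • m := Finset.sum_le_card_nsmul _ _ _ fun a ha =>
    hA a (Finset.mem_sdiff.mp ha).1 (Finset.mem_sdiff.mp ha).2
  have h4 : (B \ A).card • (m + 1) ≤ ∑ b ∈ B \ A, f b := Finset.card_nsmul_le_sum _ _ _ fun b hb =>
    hB b (Finset.mem_sdiff.mp hb).1 (Finset.mem_sdiff.mp hb).2
  rw [← Finset.sum_inter_add_sum_sdiff A B, ← Finset.sum_inter_add_sum_sdiff B A,
    Finset.inter_comm B A]
  simp only [smul_eq_mul] at h3 h4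
  rw [h1] at h3
  rw [mul_add, mul_one] at h4
  omega

/-- If the flag of a sorted `x` has a block with a descent, the two entries in the step before the
descent exceed the two entries in the step after it. So the flag has greater weight than any other
flag that differs from it only in the member between these steps. -/
theorem flagWeight_lt_of_descent (hI : I.card = 2 * k) {x : PermOn I k} (hx : IsFlagSorted x)
    {i : Fin k} (hi : x (pos i true) < x (pos i false)) {s : Finset (Finset (Fin (n + 1)))}
    (hs : IsFlag I k s) (hne : s ≠ flagOf x) {J : Finset (Fin (n + 1))} (hJ : J ∈ s)
    (he : s.erase J = (flagOf x).erase (entrySet x (pos i false))) :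
    flagWeight s < flagWeight (flagOf x) := by
  have hmem : entrySet x (pos i false) ∈ flagOf x := mem_facet.mpr ⟨i, rfl⟩
  have hJne : J ≠ entrySet x (pos i false) := by
    intro h
    rw [h] at he hJ
    exact hne (by rw [← Finset.insert_erase hJ, he, Finset.insert_erase hmem])
  have hcard : J.card = (entrySet x (pos i false)).card := by
    obtain ⟨y, -, rfl⟩ := exists_flagOf_eq hI hs
    obtain ⟨i', rfl⟩ := mem_facet.mp hJ
    by_cases h : i' = i
    · rw [h, card_entrySet, card_entrySet]
    · have h1 : entrySet y (pos i false) ∈ (flagOf y).erase (entrySet y (pos i' false)) :=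
        Finset.mem_erase.mpr ⟨fun he => h (entrySet_injective y (fun _ => false) he).symm,
          mem_facet.mpr ⟨i, rfl⟩⟩
      rw [he, Finset.mem_erase, mem_facet] at h1
      obtain ⟨h2, j, h3⟩ := h1
      have h4 := congrArg Finset.card h3
      rw [card_entrySet, card_entrySet] at h4
      have : j = i := Fin.ext (by omega)
      rw [← h3, this] at h2
      exact absurd rfl h2
  have hcomp : ∀ j ≠ i, entrySet x (pos j false) ∈ s := by
    intro j hj
    refine Finset.mem_of_mem_erase (a := J) ?_
    rw [he, Finset.mem_erase]
    exact ⟨fun h => hj (entrySet_injective x (fun _ => false) h), mem_facet.mpr ⟨j, rfl⟩⟩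
  have hbelow : ∀ j : Fin k, j < i → entrySet x (pos j false) ⊆ J := by
    intro j hj
    rcases hs.2.1.total (hcomp j hj.ne) hJ with h | h
    · exact h
    · have := Finset.card_le_card h
      rw [hcard, card_entrySet, card_entrySet] at this
      have := Fin.lt_def.mp hj
      omega
  have habove : ∀ j : Fin k, i < j → J ⊆ entrySet x (pos j false) := by
    intro j hj
    rcases hs.2.1.total (hcomp j hj.ne') hJ with h | h
    · have := Finset.card_le_card h
      rw [hcard, card_entrySet, card_entrySet] at this
      have := Fin.lt_def.mp hj
      omega
    · exact h
  rw [flagWeight, flagWeight, ← Finset.add_sum_erase _ _ hJ, ← Finset.add_sum_erase _ _ hmem, he,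
    Nat.add_lt_add_iff_right]
  have hex : ∀ a ∈ I, ∃ l, (x l : Fin (n + 1)) = a := fun a ha => ⟨x.symm ⟨a, ha⟩, by simp⟩
  have hi' : (x (pos i true) : Fin (n + 1)).val < (x (pos i false) : Fin (n + 1)).val := hi
  refine sum_lt_sum_of_threshold _ (x (pos i true) : Fin (n + 1)).val hcard hJne ?_ ?_
  · intro a ha ha'
    obtain ⟨l, rfl⟩ := hex a ((hs.1 J hJ).1 ha)
    rw [mem_entrySet_false] at ha'
    have hl : l.val ≤ 2 * i.val + 2 := by
      by_cases hik : i.val + 1 < k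
      · have := habove ⟨i.val + 1, hik⟩ (Fin.lt_def.mpr (by simp)) ha
        rw [mem_entrySet_false] at this
        simp only at this
        omega
      · have := l.isLt
        omega
    rcases Nat.lt_or_ge l.val (2 * i.val + 2) with h | h
    · have : l = pos i true := Fin.ext (by simp only [pos, Bool.toNat_true]; omega)
      rw [this]
    · exact (hx (pos i true) l (by simp only [pos, Bool.toNat_true]; omega)
        ⟨i.val, by simp [pos]⟩).le
  · intro a ha ha'
    obtain ⟨l, rfl⟩ := hex a (entrySet_subset_self x _ ha)
    rw [mem_entrySet_false] at ha
    rcases ha.lt_or_eq with h | h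
    · have hl : 2 * i.val - 1 ≤ l.val := by
        by_contra hcon
        refine ha' (hbelow ⟨i.val - 1, by omega⟩ (Fin.lt_def.mpr (by simp only; omega)) ?_)
        rw [mem_entrySet_false]
        simp only
        omega
      have : (x (pos i false) : Fin (n + 1)).val < (x l : Fin (n + 1)).val :=
        hx l (pos i false) (by simp only [pos, Bool.toNat_false]; omega)
          ⟨i.val - 1, by omega⟩
      omega
    · have : l = pos i false := Fin.ext (by simp [pos, h])
      rw [this]
      exact hi'

theorem IsAlternating.isFlagSorted {x : PermOn I k} (hx : IsAlternating x) : IsFlagSorted x :=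
  fun j l h hj => (hx j l h).2 hj

theorem IsAlternating.lt {x : PermOn I k} (hx : IsAlternating x) (i : Fin k) :
    x (pos i false) < x (pos i true) :=
  (hx _ _ (by simp [pos])).1 ⟨i.val, by simp [pos]; omega⟩

theorem isAlternating_iff {x : PermOn I k} :
    IsAlternating x ↔ IsFlagSorted x ∧ ∀ i, x (pos i false) < x (pos i true) := by
  refine ⟨fun h => ⟨h.isFlagSorted, h.lt⟩, fun h j l hl => ⟨fun hj => ?_, h.1 j l hl⟩⟩
  obtain ⟨c, hc⟩ := hj
  have hck : c < k := by have := j.isLt; omega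
  have h1 : j = pos ⟨c, hck⟩ false := Fin.ext (by simp only [pos, Bool.toNat_false]; omega)
  have h2 : l = pos ⟨c, hck⟩ true := Fin.ext (by simp only [pos, Bool.toNat_true]; omega)
  rw [h1, h2]
  exact h.2 _

/-- A cycle of full flags that vanishes at the flags of all alternating permutations is zero. -/
theorem eq_zero_of_alternating (hI : I.card = 2 * k) {z : Finset (Finset (Fin (n + 1))) →₀ ℚ}
    (hz : ∀ s ∈ z.support, IsFlag I k s) (hz0 : boundary z = 0)
    (halt : ∀ x : PermOn I k, IsAlternating x → z (flagOf x) = 0) : z = 0 := by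
  have key : ∀ (N : ℕ) (s : Finset (Finset (Fin (n + 1)))), flagWeight s = N → z s = 0 := by
    intro N
    induction N using Nat.strong_induction_on with
    | _ N ih =>
    intro s hN
    by_contra hzs
    obtain ⟨x, hx, rfl⟩ := exists_flagOf_eq hI (hz s (Finsupp.mem_support_iff.mpr hzs))
    by_cases hxa : ∀ i, x (pos i false) < x (pos i true)
    · exact hzs (halt x (isAlternating_iff.mpr ⟨hx, hxa⟩))
    push Not at hxa
    obtain ⟨i, hi⟩ := hxa
    have hi' : x (pos i true) < x (pos i false) := lt_of_le_of_ne hi fun h => by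
      have := congrArg Fin.val (x.injective h)
      simp [pos] at this
    -- The coefficient of `∂ z` at the face opposite to the `i`-th member of the flag.
    have h0 := DFunLike.congr_fun hz0 ((flagOf x).erase (entrySet x (pos i false)))
    have hmem : entrySet x (pos i false) ∈ flagOf x := mem_facet.mpr ⟨i, rfl⟩
    rw [boundary, Finsupp.linearCombination_apply, Finsupp.sum, Finsupp.finsetSum_apply,
      Finset.sum_eq_single (flagOf x), Finsupp.smul_apply, Finsupp.finsetSum_apply,
      Finset.sum_eq_single_of_mem _ hmem, Finsupp.single_eq_same] at h0
    · simp [hzs] at h0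
    · intro J hJ hJne
      refine Finsupp.single_eq_of_ne fun h => hJne ?_
      exact Finset.erase_injOn _ hJ hmem h.symm
    · intro s hs hsne
      rw [Finsupp.smul_apply, Finsupp.finsetSum_apply, Finset.sum_eq_zero, smul_zero]
      intro J hJ
      refine Finsupp.single_eq_of_ne fun h => ?_
      have := flagWeight_lt_of_descent hI hx hi' (hz s hs) hsne hJ h.symm
      exact Finsupp.mem_support_iff.mp hs (ih _ (hN ▸ this) s rfl)
    · intro h
      rw [Finsupp.notMem_support_iff.mp h, zero_smul, Finsupp.zero_apply]
  ext s
  exact key _ s rfl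

end Flags

/-! ### The classes of the alternating spheres form a basis of the homology -/

section SphereClasses

variable {n k : ℕ} {I : Finset (Fin (n + 1))}

theorem exists_facet_eq_of_sphereChain_ne_zero {x : PermOn I k}
    {s : Finset (Finset (Fin (n + 1)))} (h : sphereChain x s ≠ 0) : ∃ ε, facet x ε = s := by
  rw [sphereChain, Finsupp.finsetSum_apply] at h
  obtain ⟨ε, -, hε⟩ := Finset.exists_ne_zero_of_sum_ne_zero h
  exact ⟨ε, by_contra fun hne => hε (Finsupp.single_eq_of_ne fun h => hne h.symm)⟩

theorem sphereChain_flagOf_self {x : PermOn I k} (hx : IsAlternating x) :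
    sphereChain x (flagOf x) = 1 := by
  rw [sphereChain, Finsupp.finsetSum_apply, Finset.sum_eq_single_of_mem (fun _ => false)
    (Finset.mem_univ _)]
  · simp
  · intro ε _ hε
    refine Finsupp.single_eq_of_ne fun h => ?_
    have := flagWeight_flagOf_lt hx.lt hε
    rw [← h] at this
    exact lt_irrefl _ this

theorem flagWeight_lt_of_sphereChain_ne_zero {x y : PermOn I k} (hx : IsAlternating x)
    (hy : IsAlternating y) (hxy : x ≠ y) (h : sphereChain x (flagOf y) ≠ 0) :
    flagWeight (flagOf x) < flagWeight (flagOf y) := by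
  obtain ⟨ε, hε⟩ := exists_facet_eq_of_sphereChain_ne_zero h
  rw [← hε]
  refine flagWeight_flagOf_lt hx.lt fun h0 => hxy ?_
  rw [h0] at hε
  exact flagOf_injective hx.isFlagSorted hy.isFlagSorted hε

/-- The rows of a unitriangular matrix are linearly independent; the order on the indices is given
by a weight. -/
theorem linearIndependent_of_unitriangular {ι : Type*} [Finite ι] (M : ι → ι → ℚ) (w : ι → ℕ)
    (h1 : ∀ i, M i i = 1) (h2 : ∀ i j, i ≠ j → M i j ≠ 0 → w i < w j) :
    LinearIndependent ℚ M := by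
  have := Fintype.ofFinite ι
  rw [Fintype.linearIndependent_iff]
  intro c hc
  have key : ∀ (N : ℕ) (i : ι), w i = N → c i = 0 := by
    intro N
    induction N using Nat.strong_induction_on with
    | _ N ih =>
    intro i hi
    have := congrFun hc i
    rw [Finset.sum_apply, Finset.sum_eq_single i] at this
    · simpa [h1] using this
    · intro j _ hji
      by_cases hM : M j i = 0
      · simp [hM]
      · simp [ih _ (hi ▸ h2 j i hji hM) j rfl]
    · simp
  exact fun i => key _ i rfl

variable (k I) in
/-- The coefficients of a chain at the flags of the alternating permutations. -/
noncomputable def alternatingCoeffs : (Finset (Finset (Fin (n + 1))) →₀ ℚ) →ₗ[ℚ]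
    ({x : PermOn I k // IsAlternating x} → ℚ) :=
  LinearMap.pi fun β => Finsupp.lapply (flagOf β.1)

theorem linearIndependent_alternatingCoeffs :
    LinearIndependent ℚ fun α : {x : PermOn I k // IsAlternating x} =>
      alternatingCoeffs k I (sphereChain α.1) :=
  linearIndependent_of_unitriangular _ (fun α => flagWeight (flagOf α.1))
    (fun α => sphereChain_flagOf_self α.2) fun α β hne h =>
      flagWeight_lt_of_sphereChain_ne_zero α.2 β.2 (fun he => hne (Subtype.ext he)) h

theorem isFlag_of_mem_support_sphereChain {x : PermOn I k} {s : Finset (Finset (Fin (n + 1)))}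
    (hs : s ∈ (sphereChain x).support) : IsFlag I k s := by
  obtain ⟨ε, rfl⟩ := exists_facet_eq_of_sphereChain_ne_zero (Finsupp.mem_support_iff.mp hs)
  exact isFlag_facet x ε

theorem sphereChain_mem_supported (x : PermOn I k) :
    sphereChain x ∈ Finsupp.supported ℚ ℚ {s | IsFlag I k s} :=
  fun _ hs => isFlag_of_mem_support_sphereChain hs

theorem boundary_sphereChain (x : PermOn I k) : boundary (sphereChain x) = 0 :=
  (sphereChain_mem_cycles x).2

/-- The cycles of full flags are spanned by the fundamental cycles of the alternating permutations:
these cycles take all possible values at the alternating flags, which determine a cycle. -/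
theorem mem_span_sphereChain (hI : I.card = 2 * k) {z : Finset (Finset (Fin (n + 1))) →₀ ℚ}
    (hz : z ∈ Finsupp.supported ℚ ℚ {s | IsFlag I k s}) (hz0 : boundary z = 0) :
    z ∈ Submodule.span ℚ
      (Set.range fun α : {x : PermOn I k // IsAlternating x} => sphereChain α.1) := by
  have := Fintype.ofFinite {x : PermOn I k // IsAlternating x}
  have htop := linearIndependent_alternatingCoeffs.span_eq_top_of_card_eq_finrank' (by simp :
    Fintype.card {x : PermOn I k // IsAlternating x} =
      Module.finrank ℚ ({x : PermOn I k // IsAlternating x} → ℚ))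
  have hmem : alternatingCoeffs k I z ∈ (⊤ : Submodule ℚ _) := trivial
  rw [← htop, Submodule.mem_span_range_iff_exists_fun] at hmem
  obtain ⟨c, hc⟩ := hmem
  rw [Submodule.mem_span_range_iff_exists_fun]
  refine ⟨c, (sub_eq_zero.mp (eq_zero_of_alternating hI ?_ ?_ ?_)).symm⟩
  · have : z - ∑ α, c α • sphereChain α.1 ∈ Finsupp.supported ℚ ℚ {s | IsFlag I k s} :=
      Submodule.sub_mem _ hz (Submodule.sum_mem _ fun α _ =>
        Submodule.smul_mem _ _ (sphereChain_mem_supported α.1))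
    exact fun s hs => this hs
  · simp [hz0, boundary_sphereChain]
  · intro x hx
    have := congrFun hc ⟨x, hx⟩
    simp only [← map_smul, ← map_sum] at this
    rw [Finsupp.sub_apply, sub_eq_zero]
    exact this.symm

variable (I) in
/-- The vertices of `(K_{A_n})_I`. -/
def oddVertices : Set (Finset (Fin (n + 1))) := {J | Odd (J ∩ I).card}

theorem inf_mem_oddVertices : ∀ J ∈ oddVertices I, J ⊓ I ∈ oddVertices I := by
  intro J hJ
  simpa [oddVertices] using hJ

theorem mem_faces_oddSubcomplex_iff (hI : I.card = 2 * k) (s : Finset (Finset (Fin (n + 1)))) :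
    (s = ∅ ∨ s ∈ (oddSubcomplex n I).faces) ↔
      (∀ J ∈ s, J ∈ oddVertices I) ∧ IsChain (· ≤ ·) (s : Set (Finset (Fin (n + 1)))) := by
  constructor
  · rintro (rfl | h)
    · simp
    · exact ⟨h.2, h.1.2.2⟩
  · rintro ⟨h1, h2⟩
    rcases s.eq_empty_or_nonempty with h | h
    · exact Or.inl h
    · refine Or.inr ⟨⟨h, fun J hJ => ?_, h2⟩, h1⟩
      have hodd : Odd (J ∩ I).card := h1 J hJ
      constructor
      · rw [Finset.nonempty_iff_ne_empty]
        rintro rfl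
        simp at hodd
      · rintro rfl
        rw [Finset.univ_inter, hI] at hodd
        exact (Nat.not_odd_iff_even.mpr (even_two_mul k)) hodd

theorem mem_chains_of_simplicesWithin (hI : I.card = 2 * k) {p : ℤ} {m : ℕ}
    {z : Finset (Finset (Fin (n + 1))) →₀ ℚ}
    (hz : z ∈ Finsupp.supported ℚ ℚ (simplicesWithin (oddVertices I) I (p + 1) m)) :
    z ∈ chains (oddSubcomplex n I) p := by
  unfold chains
  refine Finsupp.supported_mono (fun s hs => ?_) hz
  exact ⟨(mem_faces_oddSubcomplex_iff hI s).mpr ⟨hs.1, hs.2.1⟩, hs.2.2.1⟩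

theorem mem_simplicesWithin_of_chains (hI : I.card = 2 * k) {p : ℤ}
    {z : Finset (Finset (Fin (n + 1))) →₀ ℚ} (hz : z ∈ chains (oddSubcomplex n I) p) :
    z ∈ Finsupp.supported ℚ ℚ (simplicesWithin (oddVertices I) I (p + 1) (p + 1).toNat) := by
  unfold chains at hz
  refine Finsupp.supported_mono (fun s hs => ?_) hz
  have h := (mem_faces_oddSubcomplex_iff hI s).mp hs.1
  exact mem_simplicesWithin_toNat I h.1 h.2 hs.2

theorem isFlag_iff {m : ℕ} (s : Finset (Finset (Fin (n + 1)))) :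
    IsFlag I m s ↔ s ∈ simplicesWithin (oddVertices I) I m 0 := by
  have hodd : ∀ J ⊆ I, J ∈ oddVertices I ↔ Odd J.card := fun J hJ => by
    change Odd (J ∩ I).card ↔ _
    rw [Finset.inter_eq_left.mpr hJ]
  rw [mem_simplicesWithin_zero_iff]
  constructor
  · rintro ⟨h1, h2, h3⟩
    exact ⟨fun J hJ => (hodd J (h1 J hJ).1).mpr (h1 J hJ).2, h2, by rw [h3],
      fun J hJ => (h1 J hJ).1⟩
  · rintro ⟨h1, h2, h3, h4⟩
    exact ⟨fun J hJ => ⟨h4 J hJ, (hodd J (h4 J hJ)).mp (h1 J hJ)⟩, h2, by exact_mod_cast h3⟩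

/-- A flag of odd subsets of `I` has at most `k` members. -/
theorem not_isFlag_succ (hI : I.card = 2 * k) (s : Finset (Finset (Fin (n + 1)))) :
    ¬ IsFlag I (k + 1) s := by
  intro hs
  have hlt : ∀ J ∈ s, J.card / 2 ∈ Finset.range k := by
    intro J hJ
    obtain ⟨c, hc⟩ := (hs.1 J hJ).2
    have := Finset.card_le_card (hs.1 J hJ).1
    rw [Finset.mem_range]
    omega
  have hinj : Set.InjOn (fun J : Finset (Fin (n + 1)) => J.card / 2) s := by
    intro J hJ L hL h
    obtain ⟨c, hc⟩ := (hs.1 J hJ).2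
    obtain ⟨d, hd⟩ := (hs.1 L hL).2
    simp only at h
    rcases hs.2.1.total hJ hL with hJL | hJL
    · exact Finset.eq_of_subset_of_card_le hJL (by omega)
    · exact (Finset.eq_of_subset_of_card_le hJL (by omega)).symm
  have := Finset.card_le_card_of_injOn _ hlt hinj
  rw [hs.2.2, Finset.card_range] at this
  omega

/-- A cycle of full flags that is a boundary in `(K_{A_n})_I` is zero: it is then also a boundary of
chains of odd subsets of `I`, and these have no chains with `k + 1` members. -/
theorem eq_zero_of_mem_boundaries (hI : I.card = 2 * k) {z : Finset (Finset (Fin (n + 1))) →₀ ℚ}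
    (hz : z ∈ Finsupp.supported ℚ ℚ {s | IsFlag I k s})
    (hb : z ∈ boundaries (oddSubcomplex n I) ((k : ℤ) - 1)) : z = 0 := by
  obtain ⟨y, hy, rfl⟩ := hb
  have hy' := mem_simplicesWithin_of_chains hI hy
  rw [sub_add_cancel] at hy'
  obtain ⟨y', hy', h⟩ := exists_boundary_eq_le inf_mem_oddVertices _
    (Finsupp.supported_mono (fun s hs => (isFlag_iff s).mp hs) hz) hy' rfl
  have : y' = 0 := by
    rw [← Finsupp.support_eq_empty, Finset.eq_empty_iff_forall_notMem]
    intro s hs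
    refine not_isFlag_succ hI s ((isFlag_iff s).mpr ?_)
    push_cast
    exact hy' hs
  rw [← h, this, map_zero]

theorem sum_smul_sphereClass {ι : Type*} [Fintype ι] (c : ι → ℚ) (x : ι → PermOn I k) :
    ∑ i, c i • sphereClass (x i) = Submodule.Quotient.mk
      (∑ i, c i • (⟨sphereChain (x i), sphereChain_mem_cycles (x i)⟩ :
        cycles (oddSubcomplex n I) ((k : ℤ) - 1))) := by
  rw [← Submodule.mkQ_apply]
  simp only [map_sum, map_smul]
  rfl

theorem linearIndependent_sphereClass (hI : I.card = 2 * k) :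
    LinearIndependent ℚ fun α : {x : PermOn I k // IsAlternating x} => sphereClass α.1 := by
  have := Fintype.ofFinite {x : PermOn I k // IsAlternating x}
  rw [Fintype.linearIndependent_iff]
  intro c hc
  have h0 : ∑ α, c α • sphereChain α.1 = 0 := by
    refine eq_zero_of_mem_boundaries hI (Submodule.sum_mem _ fun α _ =>
      Submodule.smul_mem _ _ (sphereChain_mem_supported α.1)) ?_
    rw [sum_smul_sphereClass, Submodule.Quotient.mk_eq_zero, Submodule.submoduleOf,
      Submodule.mem_comap] at hc
    simpa using hc
  refine Fintype.linearIndependent_iff.mp (linearIndependent_alternatingCoeffs (I := I) (k := k))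
    c ?_
  rw [← map_zero (alternatingCoeffs k I), ← h0]
  simp

theorem span_sphereClass (hI : I.card = 2 * k) :
    ⊤ ≤ Submodule.span ℚ
      (Set.range fun α : {x : PermOn I k // IsAlternating x} => sphereClass α.1) := by
  have := Fintype.ofFinite {x : PermOn I k // IsAlternating x}
  rintro q -
  obtain ⟨⟨z, hz⟩, rfl⟩ := Submodule.Quotient.mk_surjective _ q
  have hz1 := mem_simplicesWithin_of_chains hI hz.1
  rw [sub_add_cancel] at hz1
  obtain ⟨z', h1, h2, m, y, hy, h3⟩ := exists_homologous_le inf_mem_oddVertices _ hz1 hz.2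
  have h4 := mem_span_sphereChain hI (Finsupp.supported_mono (fun s hs => (isFlag_iff s).mpr hs) h1)
    h2
  rw [Submodule.mem_span_range_iff_exists_fun] at h4 ⊢
  obtain ⟨c, hc⟩ := h4
  refine ⟨c, ?_⟩
  rw [sum_smul_sphereClass, eq_comm, Submodule.Quotient.eq, Submodule.submoduleOf,
    Submodule.mem_comap]
  refine ⟨y, mem_chains_of_simplicesWithin hI (m := m) (by rwa [sub_add_cancel]), ?_⟩
  rw [← h3, ← hc]
  simp

end SphereClasses

/-! ### Fundamental cycles and permutations of the positions -/

section Relations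

variable {n k : ℕ} {I : Finset (Fin (n + 1))}

theorem pos_false_val (i : Fin k) : (pos i false).val = 2 * i.val := by simp [pos]

theorem pos_true_val (i : Fin k) : (pos i true).val = 2 * i.val + 1 := by simp [pos]

/-- A permutation of the positions that preserves the earlier blocks acts on `entrySet` through the
position of the last entry. -/
theorem entrySet_trans (x : PermOn I k) {σ : Equiv.Perm (Fin (2 * k))} {i : Fin k} {b b' : Bool}
    (hσ : ∀ l, (σ l).val < 2 * i.val ↔ l.val < 2 * i.val) (hb : σ (pos i b) = pos i b') :
    entrySet (σ.trans x) (pos i b) = entrySet x (pos i b') := by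
  ext a
  rw [mem_entrySet, mem_entrySet]
  constructor
  · rintro ⟨l, hl, rfl⟩
    refine ⟨σ l, ?_, rfl⟩
    rw [hσ, ← hb, σ.injective.eq_iff]
    exact hl
  · rintro ⟨l, hl, rfl⟩
    refine ⟨σ.symm l, ?_, by simp⟩
    rwa [← hσ, ← σ.injective.eq_iff, hb, Equiv.apply_symm_apply]

/-- Exchanging the entries of a block reverses the orientation of the sphere. -/
theorem sphereChain_swap_block (x : PermOn I k) (i : Fin k) :
    sphereChain ((Equiv.swap (pos i false) (pos i true)).trans x) = -sphereChain x := by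
  have hinv : Function.Involutive fun ε : Fin k → Bool => Function.update ε i (!ε i) := by
    intro ε
    simp
  unfold sphereChain
  rw [← Finset.sum_neg_distrib, ← Equiv.sum_comp hinv.toPerm]
  refine Finset.sum_congr rfl fun ε _ => ?_
  rw [Function.Involutive.coe_toPerm, ← Finsupp.single_neg]
  congr 1
  · refine Finset.image_congr fun j _ => ?_
    refine entrySet_trans x (fun l => ?_) ?_
    · have h1 := pos_false_val i
      have h2 := pos_true_val i
      rw [Equiv.swap_apply_def]
      split_ifs with h h'
      · rw [h]
        omega
      · rw [h']
        omega
      · rfl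
    · by_cases hj : j = i
      · subst hj
        rw [Function.update_self]
        cases ε j <;> simp
      · rw [Function.update_of_ne hj]
        have hne : (j : ℕ) ≠ i := fun h => hj (Fin.ext h)
        refine Equiv.swap_apply_of_ne_of_ne ?_ ?_ <;>
        · intro h
          have := congrArg Fin.val h
          have := (ε j).toNat_le
          simp only [pos, Bool.toNat_false, Bool.toNat_true] at *
          omega
  · rw [← Finset.mul_prod_erase Finset.univ _ (Finset.mem_univ i),
      ← Finset.mul_prod_erase Finset.univ (fun j => if ε j then (-1 : ℚ) else 1)
        (Finset.mem_univ i), ← neg_mul]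
    congr 1
    · cases ε i <;> simp
    · refine Finset.prod_congr rfl fun j hj => ?_
      rw [Function.update_of_ne (Finset.ne_of_mem_erase hj)]

/-- A sum over all choices of signs can be computed by averaging over the sign at `i`. -/
theorem two_smul_sum_eq {M : Type*} [AddCommGroup M] (i : Fin k) (g : (Fin k → Bool) → M) :
    (2 : ℕ) • ∑ ε, g ε = ∑ ε, (g (Function.update ε i false) + g (Function.update ε i true)) := by
  have hinv : Function.Involutive fun ε : Fin k → Bool => Function.update ε i (!ε i) := by
    intro ε
    simp
  have h : ∑ ε, g (Function.update ε i (!ε i)) = ∑ ε, g ε := Equiv.sum_comp hinv.toPerm g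
  rw [two_smul]
  nth_rewrite 1 [← h]
  rw [← Finset.sum_add_distrib]
  refine Finset.sum_congr rfl fun ε _ => ?_
  have h' : g ε = g (Function.update ε i (ε i)) := by rw [Function.update_eq_self]
  rw [h']
  cases ε i
  · rw [add_comm]
    rfl
  · rfl

/-- A flag whose members agree with those of `Δ_x` for the signs `ε` outside the blocks `i` and
`j = i + 1`, whose `i`-th member has the last entry `x p`, and whose `j`-th member misses `x q`
among the entries of the first `j + 1` blocks; its coefficient is the product of the signs outside the two
blocks. If a permutation `σ` of the positions moves only these blocks, all facets of `Δ_{xσ}` are of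
this form, with `p` and `q` the images under `σ` of a position in block `i` and one in block `j`. -/
noncomputable def twoBlockTerm (x : PermOn I k) (i j : Fin k) (ε : Fin k → Bool)
    (p q : Fin (2 * k)) : Finset (Finset (Fin (n + 1))) →₀ ℚ :=
  Finsupp.single
    (insert (((Finset.univ.filter fun l : Fin (2 * k) => l.val < 2 * i.val ∨ l = p)).image
        fun l => (x l : Fin (n + 1)))
      (insert (((Finset.univ.filter fun l : Fin (2 * k) => l.val < 2 * i.val + 4 ∧ l ≠ q)).image
        fun l => (x l : Fin (n + 1)))
        (((Finset.univ.erase i).erase j).image fun m => entrySet x (pos m (ε m)))))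
    (∏ m ∈ (Finset.univ.erase i).erase j, if ε m then (-1 : ℚ) else 1)

theorem image_filter_trans (x : PermOn I k) (σ : Equiv.Perm (Fin (2 * k)))
    {P Q : Fin (2 * k) → Prop} [DecidablePred P] [DecidablePred Q] (h : ∀ l, P l ↔ Q (σ l)) :
    ((Finset.univ.filter P).image fun l => (σ.trans x l : Fin (n + 1))) =
      (Finset.univ.filter Q).image fun l => (x l : Fin (n + 1)) := by
  ext a
  simp only [Finset.mem_image, Finset.mem_filter, Finset.mem_univ, true_and, Equiv.trans_apply]
  constructor
  · rintro ⟨l, hl, rfl⟩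
    exact ⟨σ l, (h l).mp hl, rfl⟩
  · rintro ⟨l, hl, rfl⟩
    exact ⟨σ.symm l, (h _).mpr (by simpa using hl), by simp⟩

theorem single_facet_trans (x : PermOn I k) {i j : Fin k} (hij : j.val = i.val + 1)
    {σ : Equiv.Perm (Fin (2 * k))}
    (hσ : ∀ l, l.val < 2 * i.val ∨ 2 * i.val + 4 ≤ l.val → σ l = l) (ε : Fin k → Bool)
    (b c : Bool) :
    Finsupp.single (facet (σ.trans x) (Function.update (Function.update ε j c) i b))
        (∏ m, if Function.update (Function.update ε j c) i b m then (-1 : ℚ) else 1) =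
      ((if b then (-1 : ℚ) else 1) * (if c then (-1 : ℚ) else 1)) •
        twoBlockTerm x i j ε (σ (pos i b)) (σ (pos j !c)) := by
  have hne : j ≠ i := fun h => by
    rw [h] at hij
    omega
  have hσ' : ∀ l, (σ l).val < 2 * i.val ∨ 2 * i.val + 4 ≤ (σ l).val → σ l = l := fun l h =>
    σ.injective (hσ _ h)
  have hlow : ∀ m, m ≤ 2 * i.val ∨ 2 * i.val + 4 ≤ m → ∀ l, (σ l).val < m ↔ l.val < m := by
    intro m hm l
    by_cases h1 : l.val < 2 * i.val ∨ 2 * i.val + 4 ≤ l.val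
    · rw [hσ l h1]
    · by_cases h2 : (σ l).val < 2 * i.val ∨ 2 * i.val + 4 ≤ (σ l).val
      · rw [hσ' l h2]
      · omega
  have huniv : (Finset.univ : Finset (Fin k)) =
      insert i (insert j ((Finset.univ.erase i).erase j)) := by
    rw [Finset.insert_erase (Finset.mem_erase.mpr ⟨hne, Finset.mem_univ j⟩),
      Finset.insert_erase (Finset.mem_univ i)]
  have hrest : ∀ m ∈ (Finset.univ.erase i).erase j,
      Function.update (Function.update ε j c) i b m = ε m := by
    intro m hm
    simp only [Finset.mem_erase] at hm
    rw [Function.update_of_ne hm.2.1, Function.update_of_ne hm.1]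
  rw [twoBlockTerm, Finsupp.smul_single, smul_eq_mul]
  congr 1
  · rw [facet, huniv, Finset.image_insert, Finset.image_insert, Function.update_self,
      Function.update_of_ne hne, Function.update_self, ← huniv]
    congr 1
    · have h : 2 * ((pos i b).val / 2) = 2 * i.val := by
        have := b.toNat_le
        simp only [pos]
        omega
      rw [entrySet, h]
      refine image_filter_trans x σ fun l => ?_
      rw [hlow _ (Or.inl le_rfl), σ.injective.eq_iff]
    · congr 1
      · have h : 2 * ((pos j c).val / 2) = 2 * j.val := by
          have := c.toNat_le
          simp only [pos]
          omega
        rw [entrySet, h]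
        refine image_filter_trans x σ fun l => ?_
        rw [hlow _ (Or.inr le_rfl), Ne, σ.injective.eq_iff, Fin.ext_iff, Fin.ext_iff]
        cases c <;> simp only [pos, Bool.not_false, Bool.not_true, Bool.toNat_false,
          Bool.toNat_true] <;> omega
      · refine Finset.image_congr fun m hm => ?_
        rw [hrest m hm]
        simp only [Finset.coe_erase, Finset.coe_univ, Set.mem_sdiff, Set.mem_univ, true_and,
          Set.mem_singleton_iff] at hm
        have h1 : (m : ℕ) ≠ i := fun h => hm.1 (Fin.ext h)
        have h2 : (m : ℕ) ≠ j := fun h => hm.2 (Fin.ext h)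
        have := (ε m).toNat_le
        refine entrySet_trans x (hlow _ (by omega)) (hσ _ ?_)
        simp only [pos]
        omega
  · conv_lhs => rw [huniv]
    rw [Finset.prod_insert (by simp [hne.symm]), Finset.prod_insert (by simp), Function.update_self,
      Function.update_of_ne hne, Function.update_self, mul_assoc]
    congr 2
    exact Finset.prod_congr rfl fun m hm => by rw [hrest m hm]

/-- Four times the fundamental cycle, as averaging over the signs at `i` and at `j` counts each
facet four times. -/
theorem four_smul_sphereChain_trans (x : PermOn I k) {i j : Fin k} (hij : j.val = i.val + 1)
    {σ : Equiv.Perm (Fin (2 * k))}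
    (hσ : ∀ l, l.val < 2 * i.val ∨ 2 * i.val + 4 ≤ l.val → σ l = l) :
    (4 : ℕ) • sphereChain (σ.trans x) = ∑ ε : Fin k → Bool,
      (twoBlockTerm x i j ε (σ (pos i false)) (σ (pos j true))
        - twoBlockTerm x i j ε (σ (pos i false)) (σ (pos j false))
        - twoBlockTerm x i j ε (σ (pos i true)) (σ (pos j true))
        + twoBlockTerm x i j ε (σ (pos i true)) (σ (pos j false))) := by
  rw [show (4 : ℕ) = 2 * 2 from rfl, mul_smul, sphereChain, two_smul_sum_eq i, two_smul_sum_eq j]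
  refine Finset.sum_congr rfl fun ε _ => ?_
  simp only [single_facet_trans x hij hσ]
  simp only [Bool.false_eq_true, if_false, if_true, Bool.not_false, Bool.not_true, mul_one,
    one_smul, neg_smul, mul_neg, neg_neg]
  abel

end Relations

/-! ### The relations and the straightening of permutations -/

section Straightening

variable {n k : ℕ} {I : Finset (Fin (n + 1))}

/-- The linear map that sends `x` to the fundamental cycle of `Δ_x`. -/
noncomputable def sphereChainMap (I : Finset (Fin (n + 1))) (k : ℕ) :
    (PermOn I k →₀ ℚ) →ₗ[ℚ] (Finset (Finset (Fin (n + 1))) →₀ ℚ) :=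
  Finsupp.linearCombination ℚ sphereChain

theorem sphereChainMap_vec (x : PermOn I k) (σ : Equiv.Perm (Fin (2 * k))) :
    sphereChainMap I k (vec x σ) = sphereChain (σ.trans x) := by
  simp [sphereChainMap, vec]

theorem sphereChainMap_blockRelation (x : PermOn I k) (i : Fin k) :
    sphereChainMap I k (blockRelation x i) = 0 := by
  rw [blockRelation, map_add, sphereChainMap_vec, sphereChainMap_vec, sphereChain_swap_block]
  exact add_neg_cancel _

theorem sphereChainMap_garnirRelation (x : PermOn I k) {i j : Fin k} (hij : j.val = i.val + 1) :
    sphereChainMap I k (garnirRelation x i j) = 0 := by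
  have ha := pos_false_val i
  have hb := pos_true_val i
  have hc := pos_false_val j
  have hd := pos_true_val j
  have hF := @four_smul_sphereChain_trans n k I x i j hij
  have h4 : (4 : ℕ) • sphereChainMap I k (garnirRelation x i j) = 0 := by
    simp only [garnirRelation, map_add, map_sub, sphereChainMap_vec, smul_add, smul_sub]
    generalize pos i false = a at *
    generalize pos i true = b at *
    generalize pos j false = c at *
    generalize pos j true = d at *
    have hab : a ≠ b := fun h => by rw [h] at ha; omega
    have hac : a ≠ c := fun h => by rw [h] at ha; omega
    have had : a ≠ d := fun h => by rw [h] at ha; omega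
    have hbc : b ≠ c := fun h => by rw [h] at hb; omega
    have hbd : b ≠ d := fun h => by rw [h] at hb; omega
    have hcd : c ≠ d := fun h => by rw [h] at hc; omega
    have hout : ∀ l : Fin (2 * k), l.val < 2 * i.val ∨ 2 * i.val + 4 ≤ l.val →
        l ≠ a ∧ l ≠ b ∧ l ≠ c ∧ l ≠ d := by
      intro l hl
      refine ⟨?_, ?_, ?_, ?_⟩ <;> · rintro rfl; omega
    have hs : ∀ p ∈ ({a, b, c, d} : Set (Fin (2 * k))), ∀ q ∈ ({a, b, c, d} : Set (Fin (2 * k))),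
        ∀ l : Fin (2 * k), l.val < 2 * i.val ∨ 2 * i.val + 4 ≤ l.val → Equiv.swap p q l = l := by
      intro p hp q hq l hl
      obtain ⟨h1, h2, h3, h4⟩ := hout l hl
      refine Equiv.swap_apply_of_ne_of_ne ?_ ?_
      · rintro rfl
        simp_all
      · rintro rfl
        simp_all
    have hsbc := hs b (by simp) c (by simp)
    have hsbd := hs b (by simp) d (by simp)
    have hsdc := hs d (by simp) c (by simp)
    have hsab := hs a (by simp) b (by simp)
    have hsac := hs a (by simp) c (by simp)
    rw [hF (σ := 1) fun _ _ => rfl, hF (σ := Equiv.swap b c) hsbc,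
      hF (σ := Equiv.swap b d * Equiv.swap d c) fun l hl => by
        rw [Equiv.Perm.mul_apply, hsdc l hl, hsbd l hl],
      hF (σ := Equiv.swap a b * Equiv.swap b c) fun l hl => by
        rw [Equiv.Perm.mul_apply, hsbc l hl, hsab l hl],
      hF (σ := Equiv.swap a b * Equiv.swap b d * Equiv.swap d c) fun l hl => by
        rw [Equiv.Perm.mul_apply, Equiv.Perm.mul_apply, hsdc l hl, hsbd l hl, hsab l hl],
      hF (σ := Equiv.swap a c * Equiv.swap b d) fun l hl => by
        rw [Equiv.Perm.mul_apply, hsbd l hl, hsac l hl]]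
    simp only [← Finset.sum_add_distrib, ← Finset.sum_sub_distrib]
    refine Finset.sum_eq_zero fun ε _ => ?_
    simp only [Equiv.Perm.mul_apply, Equiv.Perm.one_apply, Equiv.swap_apply_left,
      Equiv.swap_apply_right, Equiv.swap_apply_of_ne_of_ne, ne_eq, hab, hac, had, hbc, hbd, hcd,
      hab.symm, hac.symm, had.symm, hbc.symm, hbd.symm, hcd.symm, not_false_eq_true]
    abel
  simpa using h4

theorem sphereChainMap_eq_zero {r : PermOn I k →₀ ℚ} (hr : r ∈ relations I k) :
    sphereChainMap I k r = 0 := by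
  have : relations I k ≤ LinearMap.ker (sphereChainMap I k) := by
    refine Submodule.span_le.mpr ?_
    rintro _ (⟨x, i, rfl⟩ | ⟨x, i, j, hij, rfl⟩)
    · exact sphereChainMap_blockRelation x i
    · exact sphereChainMap_garnirRelation x hij
  exact this hr

/-- The measure that decreases in the straightening of a permutation: it weighs the later blocks
more than the earlier ones, and the first entry of each block more than the second one. -/
def straighteningWeight (x : PermOn I k) : ℕ :=
  ∑ l, (l.val / 2 + (1 - l.val % 2)) * (x l : Fin (n + 1)).val

theorem straighteningWeight_trans_lt (x : PermOn I k) {σ : Equiv.Perm (Fin (2 * k))}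
    (S : Finset (Fin (2 * k))) (hσ : ∀ l ∉ S, σ l = l)
    (h : ∑ l ∈ S, (l.val / 2 + (1 - l.val % 2)) * (x (σ l) : Fin (n + 1)).val <
      ∑ l ∈ S, (l.val / 2 + (1 - l.val % 2)) * (x l : Fin (n + 1)).val) :
    straighteningWeight (σ.trans x) < straighteningWeight x := by
  unfold straighteningWeight
  rw [← Finset.sum_add_sum_compl S, ← Finset.sum_add_sum_compl S]
  refine add_lt_add_of_lt_of_le h (Finset.sum_le_sum fun l hl => ?_)
  rw [Equiv.trans_apply, hσ l (Finset.mem_compl.mp hl)]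

theorem vec_one (x : PermOn I k) : vec x = Finsupp.single x 1 := rfl

/-- A descent inside a block is removed by exchanging the two entries of the block. If all blocks
are increasing and some pair `ab/cd` of consecutive blocks satisfies `a < b < c < d`, the six-term
relation expresses `ab/cd` through permutations in which the larger entries come earlier. -/
theorem single_mem_sup_span_alternating (x : PermOn I k) :
    Finsupp.single x (1 : ℚ) ∈ relations I k ⊔ Submodule.span ℚ
      (Set.range fun α : {x : PermOn I k // IsAlternating x} => Finsupp.single α.1 (1 : ℚ)) := by
  induction hN : straighteningWeight x using Nat.strong_induction_on generalizing x with
  | _ N ih =>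
  set A := relations I k ⊔ Submodule.span ℚ
    (Set.range fun α : {x : PermOn I k // IsAlternating x} => Finsupp.single α.1 (1 : ℚ))
  have hvec : ∀ σ : Equiv.Perm (Fin (2 * k)),
      straighteningWeight (σ.trans x) < straighteningWeight x → vec x σ ∈ A :=
    fun σ hσ => ih _ (hN ▸ hσ) _ rfl
  by_cases hblock : ∀ i, x (pos i false) < x (pos i true)
  · by_cases hsorted : IsFlagSorted x
    · exact Submodule.mem_sup_right (Submodule.subset_span
        ⟨⟨x, isAlternating_iff.mpr ⟨hsorted, hblock⟩⟩, rfl⟩)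
    simp only [IsFlagSorted, not_forall] at hsorted
    obtain ⟨p, q, hpq, ⟨i', hi'⟩, hlt⟩ := hsorted
    have hik : i' + 1 < k := by have := q.isLt; omega
    set i : Fin k := ⟨i', by omega⟩ with hi
    set j : Fin k := ⟨i' + 1, hik⟩ with hj
    have hr : garnirRelation x i j ∈ A :=
      Submodule.mem_sup_left (Submodule.subset_span (Or.inr ⟨x, i, j, rfl, rfl⟩))
    have h1 := hblock i
    have h2 := hblock j
    have ha := pos_false_val i
    have hb := pos_true_val i
    have hc := pos_false_val j
    have hd := pos_true_val j
    have hp : p = pos i true := Fin.ext (by rw [hb]; exact hi')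
    have hq : q = pos j false := Fin.ext (by rw [hc, hpq, hi', hj]; simp only; omega)
    rw [hp, hq, not_lt] at hlt
    rw [garnirRelation, vec_one] at hr
    simp only [hi, hj] at ha hb hc hd
    generalize pos i false = a at *
    generalize pos i true = b at *
    generalize pos j false = c at *
    generalize pos j true = d at *
    have hab : a ≠ b := fun h => by rw [h] at ha; omega
    have hac : a ≠ c := fun h => by rw [h] at ha; omega
    have had : a ≠ d := fun h => by rw [h] at ha; omega
    have hbc : b ≠ c := fun h => by rw [h] at hb; omega
    have hbd : b ≠ d := fun h => by rw [h] at hb; omega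
    have hcd : c ≠ d := fun h => by rw [h] at hc; omega
    have h3 : x b < x c := lt_of_le_of_ne hlt fun h => hbc (x.injective h)
    have h1' : (x a : Fin (n + 1)).val < (x b : Fin (n + 1)).val := h1
    have h2' : (x c : Fin (n + 1)).val < (x d : Fin (n + 1)).val := h2
    have h3' : (x b : Fin (n + 1)).val < (x c : Fin (n + 1)).val := h3
    have hw : ∀ σ : Equiv.Perm (Fin (2 * k)),
        (∀ l, l ≠ a → l ≠ b → l ≠ c → l ≠ d → σ l = l) →
        (i' + 1) * (x (σ a) : Fin (n + 1)).val + i' * (x (σ b) : Fin (n + 1)).val +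
          (i' + 2) * (x (σ c) : Fin (n + 1)).val + (i' + 1) * (x (σ d) : Fin (n + 1)).val <
        (i' + 1) * (x a : Fin (n + 1)).val + i' * (x b : Fin (n + 1)).val +
          (i' + 2) * (x c : Fin (n + 1)).val + (i' + 1) * (x d : Fin (n + 1)).val →
        vec x σ ∈ A := by
      intro σ hσ hlt
      refine hvec σ (straighteningWeight_trans_lt x {a, b, c, d} (fun l hl => ?_) ?_)
      · simp only [Finset.mem_insert, Finset.mem_singleton, not_or] at hl
        exact hσ l hl.1 hl.2.1 hl.2.2.1 hl.2.2.2
      · have wa : a.val / 2 + (1 - a.val % 2) = i' + 1 := by omega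
        have wb : b.val / 2 + (1 - b.val % 2) = i' := by omega
        have wc : c.val / 2 + (1 - c.val % 2) = i' + 2 := by omega
        have wd : d.val / 2 + (1 - d.val % 2) = i' + 1 := by omega
        have hna : a ∉ ({b, c, d} : Finset (Fin (2 * k))) := by simp [hab, hac, had]
        have hnb : b ∉ ({c, d} : Finset (Fin (2 * k))) := by simp [hbc, hbd]
        have hnc : c ∉ ({d} : Finset (Fin (2 * k))) := by simp [hcd]
        simp only [Finset.sum_insert hna, Finset.sum_insert hnb, Finset.sum_insert hnc,
          Finset.sum_singleton, wa, wb, wc, wd]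
        linarith
    have hfix : ∀ p q l : Fin (2 * k), l ≠ p → l ≠ q → Equiv.swap p q l = l :=
      fun p q l => Equiv.swap_apply_of_ne_of_ne
    have m1 := hw (Equiv.swap b c) (fun l _ hb hc _ => hfix _ _ l hb hc) (by
      simp only [Equiv.swap_apply_left, Equiv.swap_apply_right, hfix, ne_eq, hab, hac,
        hbd.symm, hcd.symm, not_false_eq_true]
      linarith)
    have m2 := hw (Equiv.swap b d * Equiv.swap d c) (fun l _ hb hc hd => by
        rw [Equiv.Perm.mul_apply, hfix _ _ l hd hc, hfix _ _ l hb hd]) (by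
      simp only [Equiv.Perm.mul_apply, Equiv.swap_apply_left, Equiv.swap_apply_right, hfix, ne_eq,
        hab, hac, had, hbc, hbd, hcd, hbc.symm, not_false_eq_true]
      linarith)
    have m3 := hw (Equiv.swap a b * Equiv.swap b c) (fun l ha hb hc _ => by
        rw [Equiv.Perm.mul_apply, hfix _ _ l hb hc, hfix _ _ l ha hb]) (by
      simp only [Equiv.Perm.mul_apply, Equiv.swap_apply_left, Equiv.swap_apply_right, hfix, ne_eq,
        hab, hac, hac.symm, had.symm, hbc.symm, hbd.symm, hcd.symm, not_false_eq_true]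
      linarith)
    have m4 := hw (Equiv.swap a b * Equiv.swap b d * Equiv.swap d c) (fun l ha hb hc hd => by
        rw [Equiv.Perm.mul_apply, Equiv.Perm.mul_apply, hfix _ _ l hd hc, hfix _ _ l hb hd,
          hfix _ _ l ha hb]) (by
      simp only [Equiv.Perm.mul_apply, Equiv.swap_apply_left, Equiv.swap_apply_right, hfix, ne_eq,
        hab, hac, had, hbc, hbd, hcd, hac.symm, had.symm, hbd.symm, hbc.symm, not_false_eq_true]
      linarith)
    have m5 := hw (Equiv.swap a c * Equiv.swap b d) (fun l ha hb hc hd => by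
        rw [Equiv.Perm.mul_apply, hfix _ _ l hb hd, hfix _ _ l ha hc]) (by
      simp only [Equiv.Perm.mul_apply, Equiv.swap_apply_left, Equiv.swap_apply_right, hfix, ne_eq,
        hab, had, hab.symm, had.symm, hbc, hbc.symm, hcd, hcd.symm, not_false_eq_true]
      linarith)
    have hsum := A.sub_mem (A.add_mem (A.sub_mem (A.sub_mem (A.add_mem hr m1) m2) m3) m4) m5
    convert hsum using 1
    abel
  · push Not at hblock
    obtain ⟨i, hi⟩ := hblock
    have hr : blockRelation x i ∈ A :=
      Submodule.mem_sup_left (Submodule.subset_span (Or.inl ⟨x, i, rfl⟩))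
    have ha := pos_false_val i
    have hb := pos_true_val i
    rw [blockRelation, vec_one] at hr
    generalize pos i false = a at *
    generalize pos i true = b at *
    have hab : a ≠ b := fun h => by rw [h] at ha; omega
    have hlt : x b < x a := lt_of_le_of_ne hi fun h => hab (x.injective h).symm
    have hlt' : (x b : Fin (n + 1)).val < (x a : Fin (n + 1)).val := hlt
    have m1 : vec x (Equiv.swap a b) ∈ A := by
      refine hvec _ (straighteningWeight_trans_lt x {a, b} (fun l hl => ?_) ?_)
      · simp only [Finset.mem_insert, Finset.mem_singleton, not_or] at hl
        exact Equiv.swap_apply_of_ne_of_ne hl.1 hl.2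
      · have wa : a.val / 2 + (1 - a.val % 2) = i.val + 1 := by omega
        have wb : b.val / 2 + (1 - b.val % 2) = i.val := by omega
        rw [Finset.sum_pair hab, Finset.sum_pair hab, wa, wb, Equiv.swap_apply_left,
          Equiv.swap_apply_right]
        linarith
    simpa using A.sub_mem hr m1

theorem span_alternating :
    ⊤ ≤ Submodule.span ℚ (Set.range fun α : {x : PermOn I k // IsAlternating x} =>
      (Submodule.Quotient.mk (Finsupp.single α.1 1) : (PermOn I k →₀ ℚ) ⧸ relations I k)) := by
  rintro q -
  obtain ⟨r, rfl⟩ := Submodule.Quotient.mk_surjective _ q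
  induction r using Finsupp.induction_linear with
  | zero => exact Submodule.zero_mem _
  | add r r' h h' => exact Submodule.add_mem _ h h'
  | single x c =>
    obtain ⟨u, hu, v, hv, huv⟩ := Submodule.mem_sup.mp (single_mem_sup_span_alternating x)
    have h : (Submodule.Quotient.mk (Finsupp.single x c) : (PermOn I k →₀ ℚ) ⧸ relations I k) =
        c • (relations I k).mkQ v := by
      rw [← mul_one c, ← smul_eq_mul, ← Finsupp.smul_single, ← huv, Submodule.Quotient.mk_smul,
        Submodule.Quotient.mk_add, (Submodule.Quotient.mk_eq_zero _).mpr hu, zero_add, smul_eq_mul,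
        mul_one, Submodule.mkQ_apply]
    rw [h]
    refine Submodule.smul_mem _ _ ?_
    have := Submodule.mem_map_of_mem (f := (relations I k).mkQ) hv
    rwa [Submodule.map_span, ← Set.range_comp] at this

variable (k I) in
/-- The map `x + M_I ↦ [Δ_x]`. -/
noncomputable def sphereClassMap : ((PermOn I k →₀ ℚ) ⧸ relations I k) →ₗ[ℚ]
    ReducedHomology (oddSubcomplex n I) ((k : ℤ) - 1) :=
  (relations I k).liftQ (Finsupp.linearCombination ℚ sphereClass) fun r hr => by
    rw [LinearMap.mem_ker, Finsupp.linearCombination_apply, Finsupp.sum, ← Finset.sum_coe_sort,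
      sum_smul_sphereClass _ fun x : r.support => x.1]
    have h := sphereChainMap_eq_zero hr
    rw [sphereChainMap, Finsupp.linearCombination_apply, Finsupp.sum, ← Finset.sum_coe_sort] at h
    rw [show ∑ x : r.support, r x.1 • (⟨sphereChain x.1, sphereChain_mem_cycles x.1⟩ :
      cycles (oddSubcomplex n I) ((k : ℤ) - 1)) = 0 from Subtype.ext (by simpa using h),
      Submodule.Quotient.mk_zero]

theorem sphereClassMap_mk (x : PermOn I k) :
    sphereClassMap k I (Submodule.Quotient.mk (Finsupp.single x 1)) = sphereClass x := by
  rw [sphereClassMap, Submodule.liftQ_apply]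
  simp

end Straightening

end Permutohedral

theorem theorem3p4 (n k : ℕ) (I : Finset (Fin (n + 1))) (hI : I.card = 2 * k) :
    ∃ e : ((Permutohedral.PermOn I k →₀ ℚ) ⧸ Permutohedral.relations I k) ≃ₗ[ℚ]
        Permutohedral.ReducedHomology (Permutohedral.oddSubcomplex n I) ((k : ℤ) - 1),
      (∀ x : Permutohedral.PermOn I k,
        e (Submodule.Quotient.mk (Finsupp.single x 1)) = Permutohedral.sphereClass x) ∧
      (∃ b : Module.Basis {x : Permutohedral.PermOn I k // Permutohedral.IsAlternating x} ℚ
          ((Permutohedral.PermOn I k →₀ ℚ) ⧸ Permutohedral.relations I k),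
        ∀ α, b α = Submodule.Quotient.mk (Finsupp.single α.1 1)) ∧
      (∃ b : Module.Basis {x : Permutohedral.PermOn I k // Permutohedral.IsAlternating x} ℚ
          (Permutohedral.ReducedHomology (Permutohedral.oddSubcomplex n I) ((k : ℤ) - 1)),
        ∀ α, b α = Permutohedral.sphereClass α.1) := by
  have hli := Permutohedral.linearIndependent_sphereClass hI
  have hli' : LinearIndependent ℚ
      fun α : {x : Permutohedral.PermOn I k // Permutohedral.IsAlternating x} =>
        (Submodule.Quotient.mk (Finsupp.single α.1 1) :
          (Permutohedral.PermOn I k →₀ ℚ) ⧸ Permutohedral.relations I k) := by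
    refine LinearIndependent.of_comp (Permutohedral.sphereClassMap k I) ?_
    simpa only [Function.comp_def, Permutohedral.sphereClassMap_mk] using hli
  let b₁ := Module.Basis.mk hli' Permutohedral.span_alternating
  let b₂ := Module.Basis.mk hli (Permutohedral.span_sphereClass hI)
  have he : (b₁.equiv b₂ (Equiv.refl _)).toLinearMap = Permutohedral.sphereClassMap k I := by
    refine b₁.ext fun α => ?_
    rw [LinearEquiv.coe_coe, Module.Basis.equiv_apply, Equiv.refl_apply, Module.Basis.mk_apply,
      Module.Basis.mk_apply, Permutohedral.sphereClassMap_mk]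
  refine ⟨b₁.equiv b₂ (Equiv.refl _), fun x => ?_, ⟨b₁, Module.Basis.mk_apply _ _⟩,
    ⟨b₂, Module.Basis.mk_apply _ _⟩⟩
  rw [← LinearEquiv.coe_coe, he, Permutohedral.sphereClassMap_mk]
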